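/- **Theorem 2.** *Model.* In the plane $\mathbb R^2$ a UAV (the corresponding UAV) is at the origin, and the other UAVs form a homogeneous Poisson point process $\Phi$ of density $\lambda>0$. Every UAV is the centre of a cluster of users. The positions of users relative to their cluster centre are i.i.d., either (Thomas, TCP) with density $\frac1{2\pi\sigma^2}e^{-\|u\|^2/(2\sigma^2)}$, $\sigma>0$, or (Matérn, MCP) with density $\frac1{\pi R^2}\mathbf U(R-\|u\|)$, $R>0$, where $\mathbf U$ is the unit step function ($\mathbf U(x)=1$ for $x\ge0$, $0$ for $x<0$). In the *fixed case* every cluster has $\bar N\ge1$ users; in the *random case* the clusters of the other UAVs have independent Poisson numbers of users with mean $\bar n\ge 1$, and the cluster of the corresponding UAV has $1+M$ users with $M$ Poisson of mean $\bar n-1$. The transmitting user $u_0$ is selected uniformly at random in the cluster of the corresponding UAV; all other users interfere. Users have altitude $h_u$, UAVs altitude $h_v\ne h_u$; $\Delta h=|h_u-h_v|$. A link at horizontal distance $r$ from the origin is in the blockage cell $\gamma=\lfloor r\sqrt{\beta_a\beta_b}\rfloor$ ($\beta_a,\beta_b>0$) and is LOS ($\kappa=L$) with probability $$p_L(\gamma)=\prod_{n=0}^{\gamma}\Bigl(1-\exp\Bigl(-\frac{(\gamma\max(h_u,h_v)-(n+\frac12)\Delta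 h)^2}{2\varepsilon^2\gamma^2}\Bigr)\Bigr),\qquad p_L(0)=1,$$ $\varepsilon>0$, and NLOS ($\kappa=N$) with probability $p_N=1-p_L$. Its channel gain is $C_\kappa(r^2+\Delta h^2)^{-\alpha_\kappa/2}\,G\,|\hat h|^2$, where $C_\kappa,\alpha_\kappa>0$, $|\hat h|^2$ is a gamma variable with shape and rate $\mathcal N_\kappa\in\{1,2,\dots\}$, and $G=o_1$ for the desired link, while for an interfering link $G=o_i$ with probability $p_i$, $i=1,\dots,4$: with main beam gains $M_t,M_r>0$, side lobe gains $m_t,m_r\ge0$, beamwidths $\theta^a_c\in[0,2\pi]$, $\theta^e_c\in[0,\pi]$ and $b_c=\frac{\theta_c^a}{2\pi}\frac{\theta_c^e}{\pi}$ for $c\in\{t,r\}$, $$(o_i)=(M_tM_r,\;m_tM_r,\;M_tm_r,\;m_tm_r),\qquad (p_i)=(b_tb_r,\;(1-b_t)b_r,\;b_t(1-b_r),\;(1-b_t)(1-b_r)).$$ The counts, the selection, the positions, the link states (given the positions), the gains and the fadings are independent. Let $I_{intra}$ be the sum of the channel gains of the interfering users of the corresponding UAV's own cluster, $I_{inter}$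 that of the users of all other clusters, $n_0^2>0$ the noise power and $P_u>0$ the transmit power of a user. With $S$ the channel gain of the desired link, the SINR is $\Upsilon_{up}=S/(I_{intra}+I_{inter}+n_0^2/P_u)$, and $P_{up}(\Upsilon)=\mathbb P[\Upsilon_{up}>\Upsilon]$. *Notation.* $f_n(w)=\frac{w}{\sigma^2}e^{-w^2/(2\sigma^2)}$ for TCP and $f_n(w)=\frac{2w}{R^2}\mathbf U(R-w)$ for MCP; $f_Q(g|q)=\frac g{\sigma^2}e^{-(g^2+q^2)/(2\sigma^2)}I_0(\frac{gq}{\sigma^2})$ for TCP, with $I_0$ the modified Bessel function of the first kind of order zero, and $$f_Q(g|q)=\tfrac{2g}{\pi R^2}\arccos\tfrac{g^2+q^2-R^2}{2gq}\,\mathbf U(g-|R-q|)\,\mathbf U(R+q-g)+\tfrac{2g}{R^2}\mathbf U(R-q-g)$$ for MCP. With $c_\gamma=\gamma/\sqrt{\beta_a\beta_b}$, $$\Lambda^\kappa_\gamma(w,s)=p_\kappa(\gamma)\sum_{i=1}^4p_i\Bigl(1+\frac{sC_\kappa o_i}{\mathcal N_\kappa(w^2+\Delta h^2)^{\alpha_\kappa/2}}\Bigr)^{-\mathcal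 N_\kappa},$$ $$O_a(s)=\sum_{\gamma\ge0}\int_{c_\gamma}^{c_{\gamma+1}}(\Lambda^L_\gamma+\Lambda^N_\gamma)(w,s)f_n(w)\,dw,\qquad O_e(s,q)=\sum_{\gamma\ge0}\int_{c_\gamma}^{c_{\gamma+1}}(\Lambda^L_\gamma+\Lambda^N_\gamma)(g,s)f_Q(g|q)\,dg,$$ and, in the fixed case, $$\mathcal L_a(s)=O_a(s)^{\bar N-1},\qquad \mathcal L_e(s)=\exp\Bigl(-2\pi\lambda\int_0^\infty(1-O_e(s,q)^{\bar N})\,q\,dq\Bigr),$$ in the random case $$\mathcal L_a(s)=e^{-(\bar n-1)(1-O_a(s))},\qquad \mathcal L_e(s)=\exp\Bigl(-2\pi\lambda\int_0^\infty(1-e^{-\bar n(1-O_e(s,q))})\,q\,dq\Bigr),$$ where $\exp(-\infty)=0$. Finally $\eta_\kappa=\mathcal N_\kappa(\mathcal N_\kappa!)^{-1/\mathcal N_\kappa}$, $a_\kappa(w)=o_1C_\kappa(w^2+\Delta h^2)^{-\alpha_\kappa/2}$ and $$\Psi^\kappa(w)=\sum_{n=1}^{\mathcal N_\kappa}(-1)^{n+1}\binom{\mathcal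 N_\kappa}{n}\exp\Bigl(-\frac{n\eta_\kappa\Upsilon n_0^2}{P_u\,a_\kappa(w)}\Bigr)\mathcal L_a\Bigl(\frac{n\eta_\kappa\Upsilon}{a_\kappa(w)}\Bigr)\mathcal L_e\Bigl(\frac{n\eta_\kappa\Upsilon}{a_\kappa(w)}\Bigr)f_n(w).$$ *Claim.* For all $s\ge0$, $\mathbb E[e^{-sI_{intra}}]=\mathcal L_a(s)$ and $\mathbb E[e^{-sI_{inter}}]=\mathcal L_e(s)$. For every threshold $\Upsilon>0$ the expression $$A(\Upsilon)=\sum_{\gamma\ge0}\int_{c_\gamma}^{c_{\gamma+1}}\bigl(p_L(\gamma)\Psi^L(w)+p_N(\gamma)\Psi^N(w)\bigr)\,dw$$ is well defined (the integrals exist and the series converges absolutely), and $P_{up}(\Upsilon)\approx A(\Upsilon)$ in the following sense. 1. $A(\Upsilon)$ is exactly the coverage probability with the conditional probability $\mathbb P[|\hat h|^2>x]$ for the fading power of the desired link in state $\kappa$ replaced by $1-(1-e^{-\eta_\kappa x})^{\mathcal N_\kappa}$, that is, $A(\Upsilon)=\mathbb E\bigl[1-(1-e^{-\eta_{\kappa_0}X})^{\mathcal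 N_{\kappa_0}}\bigr]$ with $X=\Upsilon\,(I_{intra}+I_{inter}+n_0^2/P_u)/a_{\kappa_0}(\|u_0\|)$ and $\kappa_0$ the state of the desired link. 2. $P_{up}(\Upsilon)\le A(\Upsilon)$. 3. $|P_{up}(\Upsilon)-A(\Upsilon)|\le\max_{\kappa}\sup_{x\ge0}\bigl|\mathbb P[\Gamma_\kappa>x]-\bigl(1-(1-e^{-\eta_\kappa x})^{\mathcal N_\kappa}\bigr)\bigr|$, where $\Gamma_\kappa$ is a gamma variable with shape and rate $\mathcal N_\kappa$. 4. If $\mathcal N_L=\mathcal N_N=1$, then $P_{up}(\Upsilon)=A(\Upsilon)$. -/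

import Mathlib

open MeasureTheory ProbabilityTheory
open scoped ENNReal NNReal

noncomputable section

namespace UAVUplink

/-- The horizontal plane, with the Euclidean norm. -/
abbrev Plane := EuclideanSpace ℝ (Fin 2)

/-- The two propagation states of a link: line of sight and non line of sight. -/
inductive Link where
  | los : Link
  | nlos : Link
deriving DecidableEq

instance : Fintype Link where
  elems := {Link.los, Link.nlos}
  complete := fun κ => by cases κ <;> simp

/-- The shape of a cluster: isotropic normal with standard deviation `σ` (Thomas), or uniform on a
disc of radius `R` (Matérn). -/
inductive ClusterShape where
  | thomas (σ : ℝ) (hσ : 0 < σ) : ClusterShape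
  | matern (R : ℝ) (hR : 0 < R) : ClusterShape

/-- The number of users in a cluster: a constant (fixed case) or Poisson with a given mean
(random case). -/
inductive UserNumber where
  | fixed (N : ℕ) (hN : 1 ≤ N) : UserNumber
  | random (n : ℝ) (hn : 1 ≤ n) : UserNumber

/-- The deterministic parameters of the uplink phase. In the antenna parameters, `t` stands for the
transmitters (users) and `r` for the receivers (UAVs). -/
structure Setting where
  /-- density of the UAVs -/
  lam : ℝ
  lam_pos : 0 < lam
  shape : ClusterShape
  number : UserNumber
  /-- altitude of the users -/
  hu : ℝ
  /-- altitude of the UAVs -/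
  hv : ℝ
  heights_ne : hu ≠ hv
  /-- ratio of the obstacle area to the total area -/
  betaA : ℝ
  betaA_pos : 0 < betaA
  /-- density of the obstacles -/
  betaB : ℝ
  betaB_pos : 0 < betaB
  /-- Rayleigh scale of the obstacle heights -/
  eps : ℝ
  eps_pos : 0 < eps
  /-- intercepts of the path loss -/
  C : Link → ℝ
  C_pos : ∀ κ, 0 < C κ
  /-- path loss exponents -/
  alpha : Link → ℝ
  alpha_pos : ∀ κ, 0 < alpha κ
  /-- Nakagami parameters -/
  Nak : Link → ℕ
  Nak_pos : ∀ κ, 1 ≤ Nak κ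
  /-- main beam gains -/
  Mt : ℝ
  Mt_pos : 0 < Mt
  Mr : ℝ
  Mr_pos : 0 < Mr
  /-- side lobe gains -/
  mt : ℝ
  mt_nonneg : 0 ≤ mt
  mr : ℝ
  mr_nonneg : 0 ≤ mr
  /-- half-power beamwidths in the azimuth plane -/
  thetaTa : ℝ
  thetaTa_mem : thetaTa ∈ Set.Icc 0 (2 * Real.pi)
  thetaRa : ℝ
  thetaRa_mem : thetaRa ∈ Set.Icc 0 (2 * Real.pi)
  /-- half-power beamwidths in the elevation plane -/
  thetaTe : ℝ
  thetaTe_mem : thetaTe ∈ Set.Icc 0 Real.pi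
  thetaRe : ℝ
  thetaRe_mem : thetaRe ∈ Set.Icc 0 Real.pi
  /-- transmit power of a user -/
  Pu : ℝ
  Pu_pos : 0 < Pu
  /-- power `n₀²` of the thermal noise -/
  noise : ℝ
  noise_pos : 0 < noise

/-- `exp (-x)` for `x ∈ [0, ∞]`, with `exp (-∞) = 0`. -/
def expNeg (x : ℝ≥0∞) : ℝ := if x = ∞ then 0 else Real.exp (-x.toReal)

/-- The unit step function. -/
def unitStep (x : ℝ) : ℝ := if 0 ≤ x then 1 else 0

/-- The modified Bessel function of the first kind of order zero. -/
def besselI0 (x : ℝ) : ℝ :=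
  (1 / Real.pi) * ∫ θ in (0 : ℝ)..Real.pi, Real.exp (x * Real.cos θ)

/-! ### Distributions of the users -/

/-- Density of the position of a user relative to its cluster centre. -/
def ClusterShape.density : ClusterShape → Plane → ℝ
  | .thomas σ _, u => 1 / (2 * Real.pi * σ ^ 2) * Real.exp (-(‖u‖ ^ 2 / (2 * σ ^ 2)))
  | .matern R _, u => 1 / (Real.pi * R ^ 2) * unitStep (R - ‖u‖)

/-- Law of the position of a user relative to its cluster centre. -/
def ClusterShape.law (c : ClusterShape) : Measure Plane :=
  volume.withDensity fun u => ENNReal.ofReal (c.density u)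

/-- Density `f_n` of the distance of a user to the centre of its own cluster. -/
def ClusterShape.pdfIntra : ClusterShape → ℝ → ℝ
  | .thomas σ _, w => w / σ ^ 2 * Real.exp (-(w ^ 2 / (2 * σ ^ 2)))
  | .matern R _, w => 2 * w / R ^ 2 * unitStep (R - w)

/-- Density `f_Q(g | q)` of the distance `g` to the origin of a user whose cluster centre is at
distance `q` from the origin. -/
def ClusterShape.pdfInter : ClusterShape → ℝ → ℝ → ℝ
  | .thomas σ _, g, q =>
      g / σ ^ 2 * Real.exp (-((g ^ 2 + q ^ 2) / (2 * σ ^ 2))) * besselI0 (g * q / σ ^ 2)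
  | .matern R _, g, q =>
      2 * g / (Real.pi * R ^ 2) * Real.arccos ((g ^ 2 + q ^ 2 - R ^ 2) / (2 * g * q)) *
          unitStep (g - |R - q|) * unitStep (R + q - g) +
        2 * g / R ^ 2 * unitStep (R - q - g)

/-- Law of the number of users in a cluster other than the corresponding one. -/
def UserNumber.law : UserNumber → Measure ℕ
  | .fixed N _ => Measure.dirac N
  | .random n _ => poissonMeasure n.toNNReal

/-- Law of the number of users in the corresponding cluster: `N`, or, in the random case, one
transmitting user and a Poisson number of interferers, with `n` users on average. -/
def UserNumber.typicalLaw : UserNumber → Measure ℕ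
  | .fixed N _ => Measure.dirac N
  | .random n _ => (poissonMeasure (n - 1).toNNReal).map (fun k => k + 1)

namespace Setting

variable (S : Setting)

/-! ### Blockage, path loss and antennas -/

/-- `√(βₐ β_b)`; the blockage cell `γ` is the interval of distances `[γ/√(βₐβ_b), (γ+1)/√(βₐβ_b))`. -/
def rootBeta : ℝ := Real.sqrt (S.betaA * S.betaB)

/-- The difference of the altitudes of users and UAVs. -/
def dh : ℝ := |S.hu - S.hv|

/-- The probability that a link in the blockage cell `γ` is LOS. For `γ = 0` the exponent of the only
factor of the product is `-∞`, so that the product is one. -/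
def losProb (γ : ℕ) : ℝ :=
  if γ = 0 then 1 else
    ∏ n ∈ Finset.range (γ + 1), (1 - Real.exp
      (-(((γ : ℝ) * max S.hu S.hv - ((n : ℝ) + 1 / 2) * |S.hu - S.hv|) ^ 2 /
        (2 * S.eps ^ 2 * (γ : ℝ) ^ 2))))

/-- The probability `p_κ(γ)` of the state `κ` for a link in the blockage cell `γ`. -/
def linkProb : Link → ℕ → ℝ
  | .los, γ => S.losProb γ
  | .nlos, γ => 1 - S.losProb γ

/-- The path loss of a link in state `κ` at horizontal distance `r`. -/
def pathLoss (κ : Link) (r : ℝ) : ℝ :=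
  S.C κ / Real.sqrt ((r ^ 2 + S.dh ^ 2) ^ S.alpha κ)

/-- Probability of the main beam, at the transmitter and at the receiver. -/
def beamT : ℝ := S.thetaTa / (2 * Real.pi) * (S.thetaTe / Real.pi)

def beamR : ℝ := S.thetaRa / (2 * Real.pi) * (S.thetaRe / Real.pi)

/-- The four values of the directivity gain of an interfering link; the first is the gain of the
desired link. -/
def gainValue : Fin 4 → ℝ :=
  ![S.Mt * S.Mr, S.mt * S.Mr, S.Mt * S.mr, S.mt * S.mr]

/-- The probabilities of the four values. -/
def gainProb : Fin 4 → ℝ :=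
  ![S.beamT * S.beamR, (1 - S.beamT) * S.beamR, S.beamT * (1 - S.beamR),
    (1 - S.beamT) * (1 - S.beamR)]

/-- Law of the directivity gain of an interfering link. -/
def gainLaw : Measure ℝ :=
  ∑ i : Fin 4, ENNReal.ofReal (S.gainProb i) • Measure.dirac (S.gainValue i)

/-- Law of the pair of fading powers `|ĥ|²` for the two link states: normalized gamma variables with
the Nakagami parameters. -/
def fadingLaw : Measure (Link → ℝ) :=
  Measure.pi fun κ => gammaMeasure (S.Nak κ) (S.Nak κ)

end Setting

/-! ### The random network -/

/-- The randomness attached to a user: its position relative to the cluster centre, a uniform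
variable that decides the blockage, the directivity gain of the link to the corresponding UAV if the
user is an interferer, and the fading power in each of the two link states. -/
structure Mark where
  offset : Plane
  unif : ℝ
  gain : ℝ
  fading : Link → ℝ

/-- A mark as a tuple. -/
def Mark.toProd (m : Mark) : Plane × ℝ × ℝ × (Link → ℝ) := (m.offset, m.unif, m.gain, m.fading)

instance : MeasurableSpace Mark := MeasurableSpace.comap Mark.toProd inferInstance

/-- The law of a mark: independent components. -/
def Setting.markLaw (S : Setting) : Measure (Plane × ℝ × ℝ × (Link → ℝ)) :=
  S.shape.law.prod ((volume.restrict (Set.Icc (0 : ℝ) 1)).prod (S.gainLaw.prod S.fadingLaw))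

/-- The number of points of a random sequence in a set. -/
def countIn {Ω : Type*} (V : ℕ → Ω → Plane) (A : Set Plane) (ω : Ω) : ℝ≥0∞ :=
  ∑' i, A.indicator (fun _ => (1 : ℝ≥0∞)) (V i ω)

/-- The random points `V 0, V 1, …` are an enumeration of a homogeneous Poisson point process of
density `lam` on the plane: the numbers of points in sets of finite area are Poisson with mean
`lam` times the area, and independent for disjoint sets. -/
structure IsPoissonProcess {Ω : Type*} [MeasurableSpace Ω] (μ : Measure Ω) (lam : ℝ)
    (V : ℕ → Ω → Plane) : Prop where
  measurable : ∀ i, Measurable (V i)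
  count_law : ∀ A : Set Plane, MeasurableSet A → volume A ≠ ∞ →
    μ.map (countIn V A) =
      (poissonMeasure (lam.toNNReal * (volume A).toNNReal)).map (fun k : ℕ => (k : ℝ≥0∞))
  count_indep : ∀ (m : ℕ) (A : Fin m → Set Plane), (∀ l, MeasurableSet (A l)) →
    (∀ l, volume (A l) ≠ ∞) → Pairwise (fun l l' => Disjoint (A l) (A l')) →
    iIndepFun (fun l => countIn V (A l)) μ

/-- The uplink network seen from the corresponding UAV, which is at the origin. The other UAVs are
a Poisson process, clusters and users are independent. Cluster `none` is the corresponding one,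
cluster `some i` is centred at the `i`-th other UAV; the users of a cluster are numbered from `0`. -/
structure Network (S : Setting) {Ω : Type*} [MeasurableSpace Ω] (μ : Measure Ω) where
  /-- positions of the other UAVs -/
  uav : ℕ → Ω → Plane
  /-- numbers of users in the clusters of the other UAVs -/
  count : ℕ → Ω → ℕ
  /-- number of users in the corresponding cluster -/
  count₀ : Ω → ℕ
  /-- number of the transmitting user in the corresponding cluster -/
  selected : Ω → ℕ
  /-- marks of the users -/
  mark : Option ℕ × ℕ → Ω → Mark
  uav_poisson : IsPoissonProcess μ S.lam uav
  count_measurable : ∀ i, Measurable (count i)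
  count_law : ∀ i, μ.map (count i) = S.number.law
  count₀_measurable : Measurable count₀
  selected_measurable : Measurable selected
  /-- the transmitting user is uniformly distributed among the users of the cluster -/
  selection_law : ∀ m k : ℕ, μ {ω | count₀ ω = m ∧ selected ω = k} =
    if k < m then S.number.typicalLaw {m} / (m : ℝ≥0∞) else 0
  mark_measurable : ∀ l, Measurable (mark l)
  mark_law : ∀ l, μ.map (fun ω => (mark l ω).toProd) = S.markLaw
  count_indep : iIndepFun count μ
  mark_indep : iIndepFun mark μ
  uav_indep : IndepFun (fun ω i => uav i ω)
    (fun ω => ((count₀ ω, selected ω), (fun i => count i ω), fun l => mark l ω)) μ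
  selection_indep : IndepFun (fun ω => (count₀ ω, selected ω))
    (fun ω => ((fun i => count i ω), fun l => mark l ω)) μ
  count_mark_indep : IndepFun (fun ω i => count i ω) (fun ω l => mark l ω) μ

namespace Setting

variable (S : Setting)

/-- The state of the link to the origin of a user at distance `r`: LOS with the probability of the
blockage cell of `r`. -/
def linkState (r : ℝ) (m : Mark) : Link :=
  if m.unif ≤ S.linkProb .los ⌊r * S.rootBeta⌋₊ then .los else .nlos

/-- The channel gain `H_g` between an interfering user at `u` and the origin. -/
def channelGain (u : Plane) (m : Mark) : ℝ :=
  S.pathLoss (S.linkState ‖u‖ m) ‖u‖ * m.gain * m.fading (S.linkState ‖u‖ m)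

/-- The channel gain `H_g⁰` of the desired link, with the maximal antenna gain. -/
def desiredGain (u : Plane) (m : Mark) : ℝ :=
  S.pathLoss (S.linkState ‖u‖ m) ‖u‖ * S.gainValue 0 * m.fading (S.linkState ‖u‖ m)

end Setting

namespace Network

variable {S : Setting} {Ω : Type*} [MeasurableSpace Ω] {μ : Measure Ω} (net : Network S μ)

/-- The mark of the transmitting user. -/
def mark₀ (ω : Ω) : Mark := net.mark (none, net.selected ω) ω

/-- Intra-cluster interference. -/
def intra (ω : Ω) : ℝ≥0∞ :=
  ∑ j ∈ (Finset.range (net.count₀ ω)).erase (net.selected ω),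
    ENNReal.ofReal (S.channelGain (net.mark (none, j) ω).offset (net.mark (none, j) ω))

/-- Inter-cluster interference. -/
def inter (ω : Ω) : ℝ≥0∞ :=
  ∑' i, ∑ j ∈ Finset.range (net.count i ω),
    ENNReal.ofReal (S.channelGain (net.uav i ω + (net.mark (some i, j) ω).offset)
      (net.mark (some i, j) ω))

/-- Interference plus noise, in units of the transmit power. -/
def disturbance (ω : Ω) : ℝ≥0∞ :=
  net.intra ω + net.inter ω + ENNReal.ofReal (S.noise / S.Pu)

/-- The signal to interference plus noise ratio at the corresponding UAV. -/
def sinr (ω : Ω) : ℝ≥0∞ :=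
  ENNReal.ofReal (S.desiredGain (net.mark₀ ω).offset (net.mark₀ ω)) / net.disturbance ω

/-- The uplink coverage probability for the threshold `T`. -/
def coverage (T : ℝ) : ℝ := μ.real {ω | ENNReal.ofReal T < net.sinr ω}

/-- The state of the desired link. -/
def state₀ (ω : Ω) : Link := S.linkState ‖(net.mark₀ ω).offset‖ (net.mark₀ ω)

/-- The fading level that the desired link has to exceed for the threshold `T` to be exceeded. -/
def level (T : ℝ) (ω : Ω) : ℝ≥0∞ :=
  ENNReal.ofReal (T / (S.gainValue 0 * S.pathLoss (net.state₀ ω) ‖(net.mark₀ ω).offset‖)) *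
    net.disturbance ω

end Network

/-! ### The analytical expression -/

namespace Setting

variable (S : Setting)

/-- `Λ^κ(w, s)` in the blockage cell `γ`. -/
def Lam (κ : Link) (γ : ℕ) (w s : ℝ) : ℝ :=
  S.linkProb κ γ * ∑ i : Fin 4, S.gainProb i *
    ((1 + s * S.C κ * S.gainValue i /
      ((S.Nak κ : ℝ) * Real.sqrt ((w ^ 2 + S.dh ^ 2) ^ S.alpha κ))) ^ S.Nak κ)⁻¹

/-- The end points of the blockage cells. -/
def cell (γ : ℕ) : ℝ := (γ : ℝ) / S.rootBeta

/-- `O_a(s)`. -/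
def Oa (s : ℝ) : ℝ :=
  ∑' γ : ℕ, ∫ w in S.cell γ..S.cell (γ + 1),
    (S.Lam .los γ w s + S.Lam .nlos γ w s) * S.shape.pdfIntra w

/-- `O_e(s, q)`. -/
def Oe (s q : ℝ) : ℝ :=
  ∑' γ : ℕ, ∫ g in S.cell γ..S.cell (γ + 1),
    (S.Lam .los γ g s + S.Lam .nlos γ g s) * S.shape.pdfInter g q

/-- The probability generating functional factor of one interfering cluster. -/
def clusterFactor : UserNumber → ℝ → ℝ
  | .fixed N _, x => x ^ N
  | .random n _, x => Real.exp (-(n * (1 - x)))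

/-- The expression for the Laplace transform of the intra-cluster interference. -/
def La (s : ℝ) : ℝ :=
  match S.number with
  | .fixed N _ => S.Oa s ^ (N - 1)
  | .random n _ => Real.exp (-((n - 1) * (1 - S.Oa s)))

/-- The expression for the Laplace transform of the inter-cluster interference. The integral over
`q` is a Lebesgue integral of a nonnegative function and may be infinite. -/
def Le (s : ℝ) : ℝ :=
  expNeg (ENNReal.ofReal (2 * Real.pi * S.lam) *
    ∫⁻ q in Set.Ioi (0 : ℝ), ENNReal.ofReal ((1 - clusterFactor S.number (S.Oe s q)) * q))

/-- `η_κ = N_κ (N_κ!)^(-1/N_κ)`. -/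
def eta (κ : Link) : ℝ :=
  (S.Nak κ : ℝ) * ((S.Nak κ).factorial : ℝ) ^ (-(1 : ℝ) / (S.Nak κ : ℝ))

/-- `1 - (1 - e^(-η_κ x))^(N_κ)`, which stands for the probability that the fading power in the
state `κ` exceeds `x`. -/
def approxTail (κ : Link) (x : ℝ≥0∞) : ℝ :=
  1 - (1 - expNeg (ENNReal.ofReal (S.eta κ) * x)) ^ S.Nak κ

/-- `o₁ C_κ (w² + Δh²)^(-α_κ/2)`. -/
def signalScale (κ : Link) (w : ℝ) : ℝ :=
  S.gainValue 0 * S.C κ * (w ^ 2 + S.dh ^ 2) ^ (-(S.alpha κ / 2))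

/-- `Ψ^κ(w)` for the threshold `T`. -/
def Psi (T : ℝ) (κ : Link) (w : ℝ) : ℝ :=
  ∑ n ∈ Finset.Icc 1 (S.Nak κ), (-1) ^ (n + 1) * ((S.Nak κ).choose n : ℝ) *
    Real.exp (-((n : ℝ) * S.eta κ * T * S.noise / (S.Pu * S.signalScale κ w))) *
    S.La ((n : ℝ) * S.eta κ * T / S.signalScale κ w) *
    S.Le ((n : ℝ) * S.eta κ * T / S.signalScale κ w) * S.shape.pdfIntra w

/-- The integrand in the blockage cell `γ`. -/
def integrand (T : ℝ) (γ : ℕ) (w : ℝ) : ℝ :=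
  S.linkProb .los γ * S.Psi T .los w + S.linkProb .nlos γ * S.Psi T .nlos w

/-- The analytical expression for the coverage probability. -/
def coverageFormula (T : ℝ) : ℝ :=
  ∑' γ : ℕ, ∫ w in S.cell γ..S.cell (γ + 1), S.integrand T γ w

end Setting

end UAVUplink

end

/-
Given the positions of the other UAVs, the clusters contribute independent factors to the Laplace
transform of the interference, each being the generating function of the number of interferers
evaluated at the Laplace transform of a single one. Rotation invariance reduces the latter to an
integral over the distance from the origin: integrating the cluster density over the angle gives
the Bessel integral (Thomas) or an arc length computed by arccos (Matérn). Averaging over the UAVs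
is the Laplace functional of the Poisson process.

The interference is independent of everything about the desired link, whichever user transmits, so
the coverage probability is the mean of a gamma tail at a random level. Replacing this tail by that
of the maximum of `N` independent exponentials of rate `η` and expanding `(1 - e^{-ηx})^N` by the
binomial theorem turns the mean into Laplace transforms of the interference. The replacement can
only increase the tail (Alzer's inequality): both densities have mass one, `η` makes them agree to
leading order at `0`, and the gamma density can only pass from above to below the other one.
-/

noncomputable section

namespace UAVUplink

open Set Filter Topology

/-! ### The exponential `exp (-x)` on `[0, ∞]` -/

lemma expNeg_nonneg (x : ℝ≥0∞) : 0 ≤ expNeg x := by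
  unfold expNeg; split_ifs <;> positivity

lemma expNeg_le_one (x : ℝ≥0∞) : expNeg x ≤ 1 := by
  unfold expNeg; split_ifs <;> simp

lemma expNeg_zero : expNeg 0 = 1 := by simp [expNeg]

lemma expNeg_top : expNeg ∞ = 0 := by simp [expNeg]

lemma expNeg_ofReal {x : ℝ} (hx : 0 ≤ x) : expNeg (ENNReal.ofReal x) = Real.exp (-x) := by
  simp [expNeg, ENNReal.toReal_ofReal hx]

lemma expNeg_add (x y : ℝ≥0∞) : expNeg (x + y) = expNeg x * expNeg y := by
  by_cases hx : x = ∞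
  · simp [expNeg, hx]
  by_cases hy : y = ∞
  · simp [expNeg, hy]
  simp only [expNeg, hx, hy, ENNReal.add_eq_top, or_self, if_false]
  rw [ENNReal.toReal_add hx hy, neg_add, Real.exp_add]

lemma antitone_expNeg : Antitone expNeg := by
  intro x y h
  obtain ⟨z, rfl⟩ := exists_add_of_le h
  rw [expNeg_add]
  exact mul_le_of_le_one_right (expNeg_nonneg x) (expNeg_le_one z)

lemma expNeg_pow (x : ℝ≥0∞) (n : ℕ) : expNeg x ^ n = expNeg (n * x) := by
  induction n with
  | zero => simp [expNeg_zero]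
  | succ n ih => rw [pow_succ, ih, ← expNeg_add, Nat.cast_succ, add_one_mul]

@[fun_prop]
lemma measurable_expNeg : Measurable expNeg := antitone_expNeg.measurable

/-- The function `expNeg` with values in `[0, ∞]`, for use in Lebesgue integrals. -/
def eexpNeg (x : ℝ≥0∞) : ℝ≥0∞ := ENNReal.ofReal (expNeg x)

lemma eexpNeg_eq_exp (x : ℝ≥0∞) : eexpNeg x = EReal.exp (-(x : EReal)) := by
  unfold eexpNeg expNeg
  split_ifs with h
  · simp [h]
  · lift x to ℝ≥0 using h
    have hx : -((x : ℝ≥0∞) : EReal) = ((-(x : ℝ) : ℝ) : EReal) := by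
      rw [EReal.coe_neg]; rfl
    rw [hx, EReal.exp_coe, ENNReal.coe_toReal]

lemma continuous_eexpNeg : Continuous eexpNeg := by
  rw [funext eexpNeg_eq_exp]
  exact ENNReal.continuous_exp.comp (continuous_neg.comp continuous_coe_ennreal_ereal)

@[fun_prop]
lemma measurable_eexpNeg : Measurable eexpNeg := continuous_eexpNeg.measurable

lemma antitone_eexpNeg : Antitone eexpNeg :=
  fun _ _ h => ENNReal.ofReal_le_ofReal (antitone_expNeg h)

lemma eexpNeg_zero : eexpNeg 0 = 1 := by rw [eexpNeg, expNeg_zero, ENNReal.ofReal_one]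

lemma eexpNeg_le_one (x : ℝ≥0∞) : eexpNeg x ≤ 1 := eexpNeg_zero ▸ antitone_eexpNeg zero_le

lemma eexpNeg_pos {x : ℝ≥0∞} (hx : x ≠ ∞) : 0 < eexpNeg x := by
  simp [eexpNeg, expNeg, hx, Real.exp_pos]

lemma eexpNeg_ofReal {x : ℝ} (hx : 0 ≤ x) :
    eexpNeg (ENNReal.ofReal x) = ENNReal.ofReal (Real.exp (-x)) := by
  rw [eexpNeg, expNeg_ofReal hx]

lemma eexpNeg_add (x y : ℝ≥0∞) : eexpNeg (x + y) = eexpNeg x * eexpNeg y := by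
  simp only [eexpNeg, expNeg_add, ENNReal.ofReal_mul (expNeg_nonneg x)]

lemma eexpNeg_sum {ι : Type*} (s : Finset ι) (f : ι → ℝ≥0∞) :
    eexpNeg (∑ i ∈ s, f i) = ∏ i ∈ s, eexpNeg (f i) := by
  classical
  induction s using Finset.induction_on with
  | empty => simp [eexpNeg_zero]
  | insert a s ha ih => rw [Finset.sum_insert ha, Finset.prod_insert ha, eexpNeg_add, ih]

lemma eexpNeg_natCast_mul (n : ℕ) (x : ℝ≥0∞) : eexpNeg (n * x) = eexpNeg x ^ n := by
  rw [eexpNeg, ← expNeg_pow, ENNReal.ofReal_pow (expNeg_nonneg x), eexpNeg]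

lemma one_sub_eexpNeg (x : ℝ≥0∞) : 1 - eexpNeg x = ENNReal.ofReal (1 - expNeg x) := by
  rw [eexpNeg, ENNReal.ofReal_sub _ (expNeg_nonneg x), ENNReal.ofReal_one]

lemma integral_expNeg {α : Type*} [MeasurableSpace α] {ν : Measure α} {f : α → ℝ≥0∞}
    (hf : AEMeasurable f ν) : ∫ a, expNeg (f a) ∂ν = (∫⁻ a, eexpNeg (f a) ∂ν).toReal :=
  integral_eq_lintegral_of_nonneg_ae (.of_forall fun _ => expNeg_nonneg _)
    (measurable_expNeg.comp_aemeasurable hf).aestronglyMeasurable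

/-! ### The Laplace functional of a Poisson process -/

lemma lintegral_pow_poissonMeasure (r : ℝ≥0) {x : ℝ} (hx : 0 ≤ x) :
    ∫⁻ k, ENNReal.ofReal x ^ k ∂(poissonMeasure r) =
      ENNReal.ofReal (Real.exp (-(r * (1 - x)))) := by
  have hterm (k : ℕ) : ENNReal.ofReal x ^ k * poissonMeasure r {k} =
      ENNReal.ofReal (Real.exp (-r) * ((r * x) ^ k / k.factorial)) := by
    rw [poissonMeasure_singleton, ← ENNReal.ofReal_pow hx, ← ENNReal.ofReal_mul (by positivity)]
    congr 1; rw [mul_pow]; ring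
  have hsum : HasSum (fun k : ℕ => Real.exp (-r) * ((r * x) ^ k / k.factorial))
      (Real.exp (-r) * Real.exp (r * x)) := by
    rw [Real.exp_eq_exp_ℝ]
    exact (NormedSpace.expSeries_div_hasSum_exp ((r : ℝ) * x)).mul_left _
  simp_rw [lintegral_countable', hterm]
  rw [← ENNReal.ofReal_tsum_of_nonneg (fun k => by positivity) hsum.summable, hsum.tsum_eq,
    ← Real.exp_add]
  congr 2; ring

lemma measurable_countIn {Ω : Type*} [MeasurableSpace Ω] {V : ℕ → Ω → Plane}
    (hV : ∀ i, Measurable (V i)) {A : Set Plane} (hA : MeasurableSet A) :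
    Measurable (countIn V A) :=
  Measurable.tsum fun i => (measurable_const.indicator hA).comp (hV i)

lemma apply_simpleFunc_eq_sum_indicator {α β : Type*} [MeasurableSpace α] [Zero β]
    [DecidableEq β] (f : SimpleFunc α β) {G : β → ℝ≥0∞} (hG : G 0 = 0) (a : α) :
    G (f a) = ∑ y ∈ f.range with y ≠ 0, G y * (f ⁻¹' {y}).indicator 1 a := by
  by_cases ha : f a = 0
  · rw [ha, hG]
    refine (Finset.sum_eq_zero fun y hy => ?_).symm
    have hay : f a ≠ y := fun h => (Finset.mem_filter.1 hy).2 (h ▸ ha)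
    simp [hay]
  · rw [Finset.sum_eq_single_of_mem (f a) (Finset.mem_filter.2 ⟨f.mem_range_self a, ha⟩)]
    · simp
    · intro y _ hy
      simp [hy.symm]

lemma exists_monotone_simpleFunc_tendsto {α : Type*} [MeasurableSpace α] (ν : Measure α)
    [SigmaFinite ν] {f : α → ℝ≥0∞} (hf : Measurable f) :
    ∃ g : ℕ → SimpleFunc α ℝ≥0∞, (∀ n, ν (Function.support (g n)) ≠ ∞) ∧
      (∀ a, Monotone fun n => g n a) ∧ ∀ a, Tendsto (fun n => g n a) atTop (𝓝 (f a)) := by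
  set B := spanningSets ν
  have happly (n a) : (SimpleFunc.eapprox f n).restrict (B n) a =
      (B n).indicator (SimpleFunc.eapprox f n) a :=
    SimpleFunc.restrict_apply _ (measurableSet_spanningSets ν n) a
  refine ⟨fun n => (SimpleFunc.eapprox f n).restrict (B n), fun n => ?_, fun a n m hnm => ?_,
    fun a => ?_⟩
  · refine ne_top_of_le_ne_top (measure_spanningSets_lt_top ν n).ne (measure_mono ?_)
    exact (funext (happly n)) ▸ support_indicator_subset
  · simp only [happly]
    exact (indicator_le_indicator (SimpleFunc.monotone_eapprox f hnm a)).trans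
      (indicator_le_indicator_of_subset (monotone_spanningSets ν hnm) (fun _ => zero_le) a)
  · have hlim : Tendsto (fun n => SimpleFunc.eapprox f n a) atTop (𝓝 (f a)) := by
      rw [← SimpleFunc.iSup_eapprox_apply hf a]
      exact tendsto_atTop_iSup fun n m h => SimpleFunc.monotone_eapprox f h a
    refine hlim.congr' ?_
    filter_upwards [eventually_ge_atTop (spanningSetsIndex ν a)] with n hn
    rw [happly, indicator_of_mem (monotone_spanningSets ν hn (mem_spanningSetsIndex ν a))]

lemma tendsto_tsum_of_monotone {ι : Type*} [Countable ι] {f : ℕ → ι → ℝ≥0∞} {F : ι → ℝ≥0∞}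
    (hf : ∀ i, Monotone fun n => f n i) (hF : ∀ i, Tendsto (fun n => f n i) atTop (𝓝 (F i))) :
    Tendsto (fun n => ∑' i, f n i) atTop (𝓝 (∑' i, F i)) := by
  let _ : MeasurableSpace ι := ⊤
  simpa only [lintegral_count] using lintegral_tendsto_of_tendsto_of_monotone
    (μ := Measure.count) (fun n => (measurable_of_countable (f n)).aemeasurable)
    (.of_forall hf) (.of_forall hF)

namespace IsPoissonProcess

variable {Ω : Type*} [MeasurableSpace Ω] {μ : Measure Ω} {lam : ℝ} {V : ℕ → Ω → Plane}

lemma lintegral_eexpNeg_countIn (hV : IsPoissonProcess μ lam V) {A : Set Plane}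
    (hA : MeasurableSet A) (hA' : volume A ≠ ∞) (y : ℝ≥0∞) :
    ∫⁻ ω, eexpNeg (y * countIn V A ω) ∂μ =
      eexpNeg (ENNReal.ofReal lam * (volume A * (1 - eexpNeg y))) := by
  have hmap : ∫⁻ ω, eexpNeg (y * countIn V A ω) ∂μ =
      ∫⁻ z, eexpNeg (y * z) ∂(μ.map (countIn V A)) :=
    (lintegral_map (f := fun z => eexpNeg (y * z)) (by fun_prop)
      (measurable_countIn hV.measurable hA)).symm
  have hpow (k : ℕ) : eexpNeg (y * k) = ENNReal.ofReal (expNeg y) ^ k := by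
    rw [mul_comm, eexpNeg_natCast_mul, eexpNeg]
  have hexponent : ENNReal.ofReal lam * (volume A * (1 - eexpNeg y)) =
      ENNReal.ofReal ((lam.toNNReal * (volume A).toNNReal : ℝ≥0) * (1 - expNeg y)) := by
    rw [one_sub_eexpNeg, ENNReal.ofReal_mul (by positivity), ENNReal.ofReal_coe_nnreal,
      ENNReal.coe_mul, ENNReal.coe_toNNReal hA', mul_assoc]
    rfl
  rw [hmap, hV.count_law A hA hA', lintegral_map (by fun_prop) (measurable_of_countable _)]
  simp_rw [hpow]
  rw [lintegral_pow_poissonMeasure _ (expNeg_nonneg y), hexponent, eexpNeg_ofReal]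
  exact mul_nonneg (by positivity) (sub_nonneg.2 (expNeg_le_one y))

lemma iIndepFun_countIn (hV : IsPoissonProcess μ lam V) {ι : Type*} [Finite ι]
    {A : ι → Set Plane} (hA : ∀ i, MeasurableSet (A i)) (hA' : ∀ i, volume (A i) ≠ ∞)
    (hdisj : Pairwise fun i j => Disjoint (A i) (A j)) :
    iIndepFun (fun i => countIn V (A i)) μ := by
  obtain ⟨m, ⟨e⟩⟩ := Finite.exists_equiv_fin ι
  simpa using (hV.count_indep m (fun l => A (e.symm l)) (fun l => hA _) (fun l => hA' _)
    (hdisj.comp_of_injective e.symm.injective)).precomp e.injective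

lemma lintegral_eexpNeg_sum_countIn (hV : IsPoissonProcess μ lam V) {ι : Type*} (s : Finset ι)
    {A : ι → Set Plane} (hA : ∀ i, MeasurableSet (A i)) (hA' : ∀ i ∈ s, volume (A i) ≠ ∞)
    (hdisj : Pairwise fun i j => Disjoint (A i) (A j)) (y : ι → ℝ≥0∞) :
    ∫⁻ ω, eexpNeg (∑ i ∈ s, y i * countIn V (A i) ω) ∂μ =
      eexpNeg (ENNReal.ofReal lam * ∑ i ∈ s, volume (A i) * (1 - eexpNeg (y i))) := by
  have hindep : iIndepFun (fun (i : s) ω => eexpNeg (y i * countIn V (A i) ω)) μ :=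
    (hV.iIndepFun_countIn (fun i : s => hA i) (fun i => hA' i i.2)
      (hdisj.comp_of_injective Subtype.val_injective)).comp
      (fun i z => eexpNeg (y i * z)) fun i => by fun_prop
  simp_rw [← Finset.sum_coe_sort s, eexpNeg_sum]
  rw [lintegral_prod_eq_prod_lintegral_of_indepFun Finset.univ _ hindep fun i =>
    measurable_eexpNeg.comp ((measurable_countIn hV.measurable (hA i)).const_mul _),
    Finset.mul_sum, eexpNeg_sum]
  exact Finset.prod_congr rfl fun i _ => hV.lintegral_eexpNeg_countIn (hA i) (hA' i i.2) (y i)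

lemma lintegral_eexpNeg_tsum_simpleFunc (hV : IsPoissonProcess μ lam V)
    (f : SimpleFunc Plane ℝ≥0∞) (hf : volume (Function.support f) ≠ ∞) :
    ∫⁻ ω, eexpNeg (∑' i, f (V i ω)) ∂μ =
      eexpNeg (ENNReal.ofReal lam * ∫⁻ v, (1 - eexpNeg (f v))) := by
  classical
  set s := {y ∈ f.range | y ≠ 0}
  have hfiber (y) : MeasurableSet (f ⁻¹' {y}) := f.measurableSet_fiber y
  have hfinite (y) (hy : y ∈ s) : volume (f ⁻¹' {y}) ≠ ∞ :=
    ne_top_of_le_ne_top hf (measure_mono fun v (hv : f v = y) =>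
      Function.mem_support.2 (hv ▸ (Finset.mem_filter.1 hy).2))
  have hcount (ω) : ∑' i, f (V i ω) = ∑ y ∈ s, y * countIn V (f ⁻¹' {y}) ω := by
    have hsum (v : Plane) : f v = ∑ y ∈ s, y * (f ⁻¹' {y}).indicator 1 v :=
      apply_simpleFunc_eq_sum_indicator f (G := id) rfl v
    rw [tsum_congr fun i => hsum (V i ω), Summable.tsum_finsetSum fun _ _ => ENNReal.summable]
    exact Finset.sum_congr rfl fun y _ => ENNReal.tsum_mul_left
  have hintegral : ∫⁻ v, (1 - eexpNeg (f v)) =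
      ∑ y ∈ s, volume (f ⁻¹' {y}) * (1 - eexpNeg y) := by
    rw [lintegral_congr (apply_simpleFunc_eq_sum_indicator f (G := fun z => 1 - eexpNeg z)
      (by simp [eexpNeg_zero])),
      lintegral_finsetSum _ fun y _ => (measurable_one.indicator (hfiber y)).const_mul _]
    refine Finset.sum_congr rfl fun y _ => ?_
    rw [lintegral_const_mul _ (measurable_one.indicator (hfiber y)),
      lintegral_indicator_one (hfiber y), mul_comm]
  simp_rw [hcount, hintegral]
  exact hV.lintegral_eexpNeg_sum_countIn s hfiber hfinite
    (fun y z hyz => Disjoint.preimage _ (disjoint_singleton.2 hyz)) id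

theorem lintegral_eexpNeg_tsum [IsFiniteMeasure μ] (hV : IsPoissonProcess μ lam V)
    {f : Plane → ℝ≥0∞} (hf : Measurable f) :
    ∫⁻ ω, eexpNeg (∑' i, f (V i ω)) ∂μ =
      eexpNeg (ENNReal.ofReal lam * ∫⁻ v, (1 - eexpNeg (f v))) := by
  obtain ⟨g, hgsupp, hgmono, hglim⟩ := exists_monotone_simpleFunc_tendsto volume hf
  have hleft : Tendsto (fun n => ∫⁻ ω, eexpNeg (∑' i, g n (V i ω)) ∂μ) atTop
      (𝓝 (∫⁻ ω, eexpNeg (∑' i, f (V i ω)) ∂μ)) := by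
    refine tendsto_lintegral_of_dominated_convergence (fun _ => 1) (fun n => ?_)
      (fun n => .of_forall fun ω => eexpNeg_le_one _) (by simp) (.of_forall fun ω => ?_)
    · exact measurable_eexpNeg.comp
        (Measurable.tsum fun i => (g n).measurable.comp (hV.measurable i))
    · exact (continuous_eexpNeg.tendsto _).comp
        (tendsto_tsum_of_monotone (fun i => hgmono _) fun i => hglim _)
  have hright : Tendsto (fun n => eexpNeg (ENNReal.ofReal lam * ∫⁻ v, (1 - eexpNeg (g n v))))
      atTop (𝓝 (eexpNeg (ENNReal.ofReal lam * ∫⁻ v, (1 - eexpNeg (f v))))) := by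
    refine (continuous_eexpNeg.tendsto _).comp
      (ENNReal.Tendsto.const_mul ?_ (Or.inr ENNReal.ofReal_ne_top))
    refine lintegral_tendsto_of_tendsto_of_monotone (fun n => by fun_prop)
      (.of_forall fun v n m h => tsub_le_tsub_left (antitone_eexpNeg (hgmono v h)) 1)
      (.of_forall fun v => ?_)
    exact ENNReal.Tendsto.sub tendsto_const_nhds ((continuous_eexpNeg.tendsto _).comp (hglim v))
      (Or.inl ENNReal.one_ne_top)
  refine tendsto_nhds_unique hleft (hright.congr fun n => ?_)
  exact (hV.lintegral_eexpNeg_tsum_simpleFunc (g n) (hgsupp n)).symm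

end IsPoissonProcess

/-! ### Alzer's inequality for gamma variables -/

lemma lintegral_exp_gammaMeasure {a r c : ℝ} (ha : 0 < a) (hr : 0 < r) (hc : 0 ≤ c) :
    ∫⁻ x, ENNReal.ofReal (Real.exp (-(c * x))) ∂(gammaMeasure a r) =
      ENNReal.ofReal (((1 + c / r) ^ a)⁻¹) := by
  have htilt (x : ℝ) : gammaPDF a r x * ENNReal.ofReal (Real.exp (-(c * x))) =
      ENNReal.ofReal (((1 + c / r) ^ a)⁻¹) * gammaPDF a (r + c) x := by
    simp only [gammaPDF, gammaPDFReal]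
    rw [← ENNReal.ofReal_mul (by split_ifs <;> positivity), ← ENNReal.ofReal_mul (by positivity)]
    congr 1
    split_ifs with hx
    · have hpow : (r + c) ^ a = r ^ a * (1 + c / r) ^ a := by
        rw [← Real.mul_rpow hr.le (by positivity), mul_add, mul_one, mul_div_cancel₀ c hr.ne']
      have hexp : Real.exp (-((r + c) * x)) = Real.exp (-(r * x)) * Real.exp (-(c * x)) := by
        rw [← Real.exp_add]; congr 1; ring
      have : (1 + c / r) ^ a ≠ 0 := by positivity
      rw [hpow, hexp]
      field_simp
    · simp
  have hpdf : Measurable (gammaPDF a r) := (measurable_gammaPDFReal a r).ennreal_ofReal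
  rw [gammaMeasure, lintegral_withDensity_eq_lintegral_mul _ hpdf (by fun_prop)]
  simp only [Pi.mul_apply, htilt]
  have hpdf' : Measurable (gammaPDF a (r + c)) :=
    (measurable_gammaPDFReal a (r + c)).ennreal_ofReal
  rw [lintegral_const_mul _ hpdf', lintegral_gammaPDF_eq_one ha (by positivity), mul_one]

lemma gammaMeasure_Iic_zero (a r : ℝ) : gammaMeasure a r (Iic 0) = 0 := by
  rw [gammaMeasure, withDensity_apply _ measurableSet_Iic, setLIntegral_congr Iio_ae_eq_Iic.symm]
  exact lintegral_gammaPDF_of_nonpos le_rfl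

lemma ae_nonneg_gammaMeasure (a r : ℝ) : ∀ᵐ x ∂(gammaMeasure a r), 0 ≤ x :=
  ae_iff.2 (measure_mono_null (fun _ hx => (not_le.1 hx).le) (gammaMeasure_Iic_zero a r))

lemma integrable_gammaPDFReal {a r : ℝ} (ha : 0 < a) (hr : 0 < r) :
    Integrable (gammaPDFReal a r) := by
  refine ⟨(measurable_gammaPDFReal a r).aestronglyMeasurable, ?_⟩
  rw [hasFiniteIntegral_iff_ofReal (Eventually.of_forall fun x => gammaPDFReal_nonneg ha hr x)]
  exact (lintegral_gammaPDF_eq_one ha hr).trans_lt ENNReal.one_lt_top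

lemma gammaMeasure_real_Ioi {a r : ℝ} (ha : 0 < a) (hr : 0 < r) (x : ℝ) :
    (gammaMeasure a r).real (Ioi x) = ∫ t in Ioi x, gammaPDFReal a r t := by
  rw [measureReal_def, gammaMeasure, withDensity_apply _ measurableSet_Ioi,
    integral_eq_lintegral_of_nonneg_ae
      (Eventually.of_forall fun t => gammaPDFReal_nonneg ha hr t)
      (measurable_gammaPDFReal a r).aestronglyMeasurable]
  rfl

lemma gammaMeasure_real_Ioi_zero {a r : ℝ} (ha : 0 < a) (hr : 0 < r) :
    (gammaMeasure a r).real (Ioi 0) = 1 := by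
  have := isProbabilityMeasure_gammaMeasure ha hr
  rw [measureReal_def, ENNReal.toReal_eq_one_iff, ← prob_compl_eq_zero_iff measurableSet_Ioi,
    compl_Ioi]
  exact gammaMeasure_Iic_zero a r

lemma mgf_mul_le_rpow {Ω : Type*} [MeasurableSpace Ω] {μ : Measure Ω} [IsProbabilityMeasure μ]
    {X : Ω → ℝ} {s θ : ℝ} (hX : s ∈ integrableExpSet X μ) (hθ : θ ∈ Icc 0 1) :
    mgf X μ (θ * s) ≤ mgf X μ s ^ θ := by
  have hpow : (fun ω => Real.exp (s * X ω) ^ θ) = fun ω => Real.exp (θ * s * X ω) := by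
    ext ω; rw [← Real.exp_mul]; congr 1; ring
  have hθX : θ * s ∈ integrableExpSet X μ :=
    convex_integrableExpSet.smul_mem_of_zero_mem (by simp [integrableExpSet]) hX hθ
  have hjensen := (Real.concaveOn_rpow hθ.1 hθ.2).le_map_integral
    (Real.continuous_rpow_const hθ.1).continuousOn isClosed_Ici
    (Eventually.of_forall fun ω => (Real.exp_pos (s * X ω)).le) hX
    (show Integrable (fun ω => Real.exp (s * X ω) ^ θ) μ from hpow ▸ hθX)
  simpa only [hpow, mgf] using hjensen

lemma mgf_uniform_Icc_neg {s : ℝ} (hs : s ≠ 0) :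
    mgf id (volume.restrict (Icc (0 : ℝ) 1)) (-s) = (1 - Real.exp (-s)) / s := by
  change ∫ u in Icc (0 : ℝ) 1, Real.exp (-s * u) = _
  rw [integral_Icc_eq_integral_Ioc, ← intervalIntegral.integral_of_le zero_le_one,
    intervalIntegral.integral_comp_mul_left _ (neg_ne_zero.2 hs), integral_exp, smul_eq_mul]
  simp only [mul_one, mul_zero, Real.exp_zero]
  field_simp
  ring

lemma one_sub_exp_div_le_rpow {s θ : ℝ} (hs : s ≠ 0) (hθ : θ ∈ Ioc 0 1) :
    (1 - Real.exp (-(θ * s))) / (θ * s) ≤ ((1 - Real.exp (-s)) / s) ^ θ := by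
  have : IsProbabilityMeasure (volume.restrict (Icc (0 : ℝ) 1)) := ⟨by simp⟩
  rw [← mgf_uniform_Icc_neg hs, ← mgf_uniform_Icc_neg (mul_ne_zero hθ.1.ne' hs), ← mul_neg]
  refine mgf_mul_le_rpow ?_ (Ioc_subset_Icc_self hθ)
  exact integrable_exp_mul_of_mem_Icc aemeasurable_id (ae_restrict_mem measurableSet_Icc)

/-- The rate of the `N` independent exponential variables whose maximum has the same density to
leading order at zero as a gamma variable with shape `N` and rate `r`. -/
def alzerRate (N : ℕ) (r : ℝ) : ℝ := r * (N.factorial : ℝ) ^ (-(1 : ℝ) / (N : ℝ))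

lemma alzerRate_pos (N : ℕ) {r : ℝ} (hr : 0 < r) : 0 < alzerRate N r := by
  unfold alzerRate; positivity

lemma alzerRate_pow {N : ℕ} (hN : N ≠ 0) (r : ℝ) : alzerRate N r ^ N = r ^ N / N.factorial := by
  have : (N : ℝ) ≠ 0 := by exact_mod_cast hN
  rw [alzerRate, mul_pow, ← Real.rpow_natCast ((N.factorial : ℝ) ^ (-(1 : ℝ) / (N : ℝ))),
    ← Real.rpow_mul (by positivity), div_mul_cancel₀ _ this, Real.rpow_neg_one, div_eq_mul_inv]

lemma gammaPDFReal_natCast {N : ℕ} (hN : N ≠ 0) (r : ℝ) {t : ℝ} (ht : 0 < t) :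
    gammaPDFReal N r t = N * alzerRate N r ^ N * t ^ (N - 1) * Real.exp (-(r * t)) := by
  obtain ⟨n, rfl⟩ := Nat.exists_eq_succ_of_ne_zero hN
  have hexp : ((n.succ : ℕ) : ℝ) - 1 = n := by push_cast; ring
  rw [gammaPDFReal, if_pos ht.le, alzerRate_pow hN, Real.rpow_natCast, hexp, Real.rpow_natCast,
    Nat.cast_succ, Real.Gamma_nat_eq_factorial, Nat.succ_eq_add_one, Nat.add_sub_cancel,
    Nat.factorial_succ]
  push_cast
  field_simp

/-- The density on `[0, ∞)` of the maximum of `N` independent exponential variables of rate `η`. -/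
def maxExpDensity (N : ℕ) (η t : ℝ) : ℝ :=
  N * η * Real.exp (-(η * t)) * (1 - Real.exp (-(η * t))) ^ (N - 1)

lemma one_sub_exp_neg_nonneg {x : ℝ} (hx : 0 ≤ x) : 0 ≤ 1 - Real.exp (-x) :=
  sub_nonneg.2 (Real.exp_le_one_iff.2 (neg_nonpos.2 hx))

lemma maxExpDensity_nonneg (N : ℕ) {η t : ℝ} (hη : 0 ≤ η) (ht : 0 ≤ t) :
    0 ≤ maxExpDensity N η t := by
  have := one_sub_exp_neg_nonneg (mul_nonneg hη ht)
  unfold maxExpDensity; positivity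

lemma hasDerivAt_one_sub_exp_pow (N : ℕ) (η t : ℝ) :
    HasDerivAt (fun t => (1 - Real.exp (-(η * t))) ^ N) (maxExpDensity N η t) t := by
  have hlin : HasDerivAt (fun t : ℝ => -(η * t)) (-(η * 1)) t :=
    ((hasDerivAt_id t).const_mul _).neg
  exact ((hlin.exp.const_sub 1).pow N).congr_deriv (by unfold maxExpDensity; ring)

lemma tendsto_one_sub_exp_pow (N : ℕ) {η : ℝ} (hη : 0 < η) :
    Tendsto (fun t : ℝ => (1 - Real.exp (-(η * t))) ^ N) atTop (𝓝 1) := by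
  have hexp : Tendsto (fun t : ℝ => Real.exp (-(η * t))) atTop (𝓝 0) :=
    Real.tendsto_exp_neg_atTop_nhds_zero.comp (tendsto_id.const_mul_atTop hη)
  simpa using (hexp.const_sub 1).pow N

lemma integrableOn_maxExpDensity (N : ℕ) {η x : ℝ} (hη : 0 < η) (hx : 0 ≤ x) :
    IntegrableOn (maxExpDensity N η) (Ioi x) :=
  integrableOn_Ioi_deriv_of_nonneg' (fun t _ => hasDerivAt_one_sub_exp_pow N η t)
    (fun _ ht => maxExpDensity_nonneg N hη.le (hx.trans (le_of_lt ht)))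
    (tendsto_one_sub_exp_pow N hη)

lemma setIntegral_maxExpDensity_Ioi (N : ℕ) {η x : ℝ} (hη : 0 < η) (hx : 0 ≤ x) :
    ∫ t in Ioi x, maxExpDensity N η t = 1 - (1 - Real.exp (-(η * x))) ^ N :=
  integral_Ioi_of_hasDerivAt_of_nonneg' (fun t _ => hasDerivAt_one_sub_exp_pow N η t)
    (fun _ ht => maxExpDensity_nonneg N hη.le (hx.trans (le_of_lt ht)))
    (tendsto_one_sub_exp_pow N hη)

lemma maxExpDensity_le_gammaPDFReal_iff {N : ℕ} (hN : N ≠ 0) {r t : ℝ} (hr : 0 < r)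
    (ht : 0 < t) :
    maxExpDensity N (alzerRate N r) t ≤ gammaPDFReal N r t ↔
      ((1 - Real.exp (-(alzerRate N r * t))) / (alzerRate N r * t)) ^ (N - 1) ≤
        Real.exp (-((r - alzerRate N r) * t)) := by
  have hη := alzerRate_pos N hr
  have hexp : Real.exp (-(r * t)) =
      Real.exp (-(alzerRate N r * t)) * Real.exp (-((r - alzerRate N r) * t)) := by
    rw [← Real.exp_add]; congr 1; ring
  have hsub : gammaPDFReal N r t - maxExpDensity N (alzerRate N r) t =
      N * alzerRate N r ^ N * t ^ (N - 1) * Real.exp (-(alzerRate N r * t)) *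
        (Real.exp (-((r - alzerRate N r) * t)) -
          ((1 - Real.exp (-(alzerRate N r * t))) / (alzerRate N r * t)) ^ (N - 1)) := by
    rw [gammaPDFReal_natCast hN r ht, maxExpDensity, hexp, div_pow, mul_pow]
    obtain ⟨n, rfl⟩ := Nat.exists_eq_succ_of_ne_zero hN
    simp only [Nat.succ_eq_add_one, Nat.add_sub_cancel, pow_succ (alzerRate (n + 1) r) n]
    field_simp
  rw [← sub_nonneg, hsub, mul_nonneg_iff_of_pos_left (by positivity), sub_nonneg]

-- The quotient `(1 - e^(-s)) / s` is the Laplace transform of a uniform variable, hence log-convex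
-- in `s`, whereas the exponential it is compared with is log-linear.
lemma maxExpDensity_le_gammaPDFReal_of_le {N : ℕ} (hN : N ≠ 0) {r a b : ℝ} (hr : 0 < r)
    (ha : 0 < a) (hab : a ≤ b)
    (hb : maxExpDensity N (alzerRate N r) b ≤ gammaPDFReal N r b) :
    maxExpDensity N (alzerRate N r) a ≤ gammaPDFReal N r a := by
  have hη := alzerRate_pos N hr
  have hb0 : 0 < b := ha.trans_le hab
  rw [maxExpDensity_le_gammaPDFReal_iff hN hr ha]
  rw [maxExpDensity_le_gammaPDFReal_iff hN hr hb0] at hb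
  set η := alzerRate N r
  have hnonneg {t : ℝ} (ht : 0 < t) : 0 ≤ (1 - Real.exp (-(η * t))) / (η * t) :=
    div_nonneg (one_sub_exp_neg_nonneg (mul_pos hη ht).le) (by positivity)
  have hlogconvex : (1 - Real.exp (-(η * a))) / (η * a) ≤
      ((1 - Real.exp (-(η * b))) / (η * b)) ^ (a / b) := by
    have hab' : η * a = a / b * (η * b) := by field_simp
    rw [hab']
    exact one_sub_exp_div_le_rpow (mul_pos hη hb0).ne' ⟨div_pos ha hb0, (div_le_one hb0).2 hab⟩
  calc ((1 - Real.exp (-(η * a))) / (η * a)) ^ (N - 1)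
      ≤ (((1 - Real.exp (-(η * b))) / (η * b)) ^ (a / b)) ^ (N - 1) :=
        pow_le_pow_left₀ (hnonneg ha) hlogconvex _
    _ = (((1 - Real.exp (-(η * b))) / (η * b)) ^ (N - 1)) ^ (a / b) :=
        Real.rpow_pow_comm (hnonneg hb0) _ _
    _ ≤ Real.exp (-((r - η) * b)) ^ (a / b) :=
        Real.rpow_le_rpow (pow_nonneg (hnonneg hb0) _) hb (by positivity)
    _ = Real.exp (-((r - η) * a)) := by
        rw [← Real.exp_mul]; congr 1; field_simp

lemma setIntegral_Ioi_le_of_single_crossing {p q : ℝ → ℝ} {a x : ℝ} (hp : IntegrableOn p (Ioi a))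
    (hq : IntegrableOn q (Ioi a)) (hpq : ∫ t in Ioi a, p t = ∫ t in Ioi a, q t)
    (hcross : ∀ ⦃s t⦄, a < s → s ≤ t → q t ≤ p t → q s ≤ p s) (hax : a ≤ x) :
    ∫ t in Ioi x, p t ≤ ∫ t in Ioi x, q t := by
  have hsplit {f : ℝ → ℝ} (hf : IntegrableOn f (Ioi a)) :
      ∫ t in Ioi a, f t = (∫ t in Ioc a x, f t) + ∫ t in Ioi x, f t := by
    rw [← Ioc_union_Ioi_eq_Ioi hax]
    exact setIntegral_union (Ioc_disjoint_Ioi le_rfl) measurableSet_Ioi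
      (hf.mono_set Ioc_subset_Ioi_self) (hf.mono_set (Ioi_subset_Ioi hax))
  by_cases h : ∃ t, x < t ∧ q t ≤ p t
  · obtain ⟨t, hxt, ht⟩ := h
    have hbelow : ∫ s in Ioc a x, q s ≤ ∫ s in Ioc a x, p s :=
      setIntegral_mono_on (hq.mono_set Ioc_subset_Ioi_self) (hp.mono_set Ioc_subset_Ioi_self)
        measurableSet_Ioc fun s hs => hcross hs.1 (hs.2.trans hxt.le) ht
    linarith [hsplit hp, hsplit hq]
  · push Not at h
    exact setIntegral_mono_on (hp.mono_set (Ioi_subset_Ioi hax))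
      (hq.mono_set (Ioi_subset_Ioi hax)) measurableSet_Ioi fun t ht => (h t ht).le

theorem gammaMeasure_real_Ioi_le {N : ℕ} (hN : N ≠ 0) {r x : ℝ} (hr : 0 < r) (hx : 0 ≤ x) :
    (gammaMeasure N r).real (Ioi x) ≤ 1 - (1 - Real.exp (-(alzerRate N r * x))) ^ N := by
  have hN0 : (0 : ℝ) < N := by positivity
  have hη := alzerRate_pos N hr
  rw [gammaMeasure_real_Ioi hN0 hr, ← setIntegral_maxExpDensity_Ioi N hη hx]
  refine setIntegral_Ioi_le_of_single_crossing (integrable_gammaPDFReal hN0 hr).integrableOn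
    (integrableOn_maxExpDensity N hη le_rfl) ?_
    (fun _ _ hs hst ht => maxExpDensity_le_gammaPDFReal_of_le hN hr hs hst ht) hx
  rw [← gammaMeasure_real_Ioi hN0 hr, gammaMeasure_real_Ioi_zero hN0 hr,
    setIntegral_maxExpDensity_Ioi N hη le_rfl]
  simp [hN]

lemma alzerRate_one (r : ℝ) : alzerRate 1 r = r := by simp [alzerRate]

lemma gammaMeasure_one_real_Ioi {r x : ℝ} (hr : 0 < r) (hx : 0 ≤ x) :
    (gammaMeasure 1 r).real (Ioi x) = Real.exp (-(r * x)) := by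
  have htail := setIntegral_maxExpDensity_Ioi 1 hr hx
  rw [pow_one, sub_sub_cancel] at htail
  rw [gammaMeasure_real_Ioi one_pos hr, ← htail]
  refine setIntegral_congr_fun measurableSet_Ioi fun t ht => ?_
  simpa [maxExpDensity, alzerRate_one] using gammaPDFReal_natCast one_ne_zero r (hx.trans_lt ht)

/-! ### Polar coordinates in the plane -/

lemma exists_linearIsometryEquiv_complex (v : Plane) :
    ∃ e : ℂ ≃ₗᵢ[ℝ] Plane, e (‖v‖ : ℂ) = v := by
  set w := Complex.orthonormalBasisOneI.repr.symm v with hw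
  refine ⟨(rotation (Circle.exp w.arg)).trans Complex.orthonormalBasisOneI.repr, ?_⟩
  have hnorm : ‖v‖ = ‖w‖ := by rw [hw, LinearIsometryEquiv.norm_map]
  rw [LinearIsometryEquiv.trans_apply, rotation_apply, Circle.coe_exp, hnorm, mul_comm,
    Complex.norm_mul_exp_arg_mul_I, hw, LinearIsometryEquiv.apply_symm_apply]

/-- The side opposite to the angle `θ` in a triangle whose other two sides are `g` and `q`. -/
def thirdSide (g q θ : ℝ) : ℝ := Real.sqrt (g ^ 2 + q ^ 2 - 2 * g * q * Real.cos θ)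

@[fun_prop]
lemma measurable_thirdSide {α : Type*} [MeasurableSpace α] {g q θ : α → ℝ} (hg : Measurable g)
    (hq : Measurable q) (hθ : Measurable θ) : Measurable fun x => thirdSide (g x) (q x) (θ x) := by
  unfold thirdSide; fun_prop

lemma sq_thirdSide (g q θ : ℝ) :
    thirdSide g q θ ^ 2 = g ^ 2 + q ^ 2 - 2 * g * q * Real.cos θ := by
  have hsq : g ^ 2 + q ^ 2 - 2 * g * q * Real.cos θ =
      (g - q * Real.cos θ) ^ 2 + (q * Real.sin θ) ^ 2 := by
    linear_combination -q ^ 2 * Real.sin_sq_add_cos_sq θ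
  exact Real.sq_sqrt (hsq ▸ by positivity)

lemma thirdSide_zero {g : ℝ} (hg : 0 ≤ g) (θ : ℝ) : thirdSide g 0 θ = g := by
  simp [thirdSide, Real.sqrt_sq hg]

lemma thirdSide_le_iff {g q R : ℝ} (hg : 0 < g) (hq : 0 < q) (hR : 0 ≤ R) (θ : ℝ) :
    thirdSide g q θ ≤ R ↔ (g ^ 2 + q ^ 2 - R ^ 2) / (2 * g * q) ≤ Real.cos θ := by
  rw [thirdSide, Real.sqrt_le_left hR, div_le_iff₀ (by positivity)]
  constructor <;> intro h <;> linarith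

lemma norm_polarCoord_symm_sub_ofReal (g θ q : ℝ) :
    ‖Complex.polarCoord.symm (g, θ) - (q : ℂ)‖ = thirdSide g q θ := by
  rw [Complex.norm_def, Complex.normSq_apply, thirdSide]
  congr 1
  simp only [Complex.polarCoord_symm_apply, Complex.sub_re, Complex.sub_im, Complex.mul_re,
    Complex.mul_im, Complex.add_re, Complex.add_im, Complex.ofReal_re, Complex.ofReal_im,
    Complex.I_re, Complex.I_im]
  linear_combination g ^ 2 * Real.sin_sq_add_cos_sq θ

lemma lintegral_norm_mul_norm_sub {h ρ : ℝ → ℝ≥0∞} (hh : Measurable h) (hρ : Measurable ρ)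
    (v : Plane) :
    ∫⁻ x : Plane, h ‖x‖ * ρ ‖x - v‖ =
      ∫⁻ g in Ioi (0 : ℝ), ENNReal.ofReal g * h g *
        ∫⁻ θ in Ioo (-Real.pi) Real.pi, ρ (thirdSide g ‖v‖ θ) := by
  obtain ⟨e, he⟩ := exists_linearIsometryEquiv_complex v
  have hcomplex : ∫⁻ x : Plane, h ‖x‖ * ρ ‖x - v‖ = ∫⁻ z : ℂ, h ‖z‖ * ρ ‖z - (‖v‖ : ℂ)‖ := by
    rw [← e.measurePreserving.lintegral_comp (by fun_prop)]
    refine lintegral_congr fun z => ?_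
    rw [LinearIsometryEquiv.norm_map]
    conv_lhs => rw [← he, ← map_sub, LinearIsometryEquiv.norm_map]
  have hpolar : ∀ p ∈ Ioi (0 : ℝ) ×ˢ Ioo (-Real.pi) Real.pi,
      ENNReal.ofReal p.1 • (h ‖Complex.polarCoord.symm p‖ *
        ρ ‖Complex.polarCoord.symm p - (‖v‖ : ℂ)‖) =
      ENNReal.ofReal p.1 * h p.1 * ρ (thirdSide p.1 ‖v‖ p.2) := by
    rintro ⟨g, θ⟩ ⟨hg, _⟩
    rw [norm_polarCoord_symm_sub_ofReal, Complex.norm_polarCoord_symm, abs_of_pos hg, smul_eq_mul,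
      mul_assoc]
  rw [hcomplex, ← Complex.lintegral_comp_polarCoord_symm]
  change ∫⁻ p in Ioi (0 : ℝ) ×ˢ Ioo (-Real.pi) Real.pi, _ = _
  rw [setLIntegral_congr_fun (measurableSet_Ioi.prod measurableSet_Ioo) hpolar,
    Measure.volume_eq_prod, ← Measure.prod_restrict]
  refine (lintegral_prod _ ?_).trans ?_
  · exact Measurable.aemeasurable (by fun_prop)
  · exact lintegral_congr fun g => lintegral_const_mul (ENNReal.ofReal g * h g)
      (f := fun θ => ρ (thirdSide g ‖v‖ θ)) (by fun_prop)

lemma lintegral_Ioo_neg_pi_pi_const (a : ℝ≥0∞) :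
    ∫⁻ _ in Ioo (-Real.pi) Real.pi, a = ENNReal.ofReal (2 * Real.pi) * a := by
  rw [setLIntegral_const, Real.volume_Ioo, sub_neg_eq_add, ← two_mul, mul_comm]

lemma lintegral_norm {h : ℝ → ℝ≥0∞} (hh : Measurable h) :
    ∫⁻ x : Plane, h ‖x‖ = ∫⁻ g in Ioi (0 : ℝ), ENNReal.ofReal (2 * Real.pi * g) * h g := by
  have hpolar := lintegral_norm_mul_norm_sub hh (ρ := fun _ => 1) measurable_const 0
  simp only [mul_one, lintegral_Ioo_neg_pi_pi_const] at hpolar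
  rw [hpolar]
  refine lintegral_congr fun g => ?_
  rw [ENNReal.ofReal_mul (by positivity : 0 ≤ 2 * Real.pi)]
  ring

lemma volume_restrict_setOf_le_cos (x : ℝ) :
    volume.restrict (Ioo (-Real.pi) Real.pi) {θ | x ≤ Real.cos θ} =
      ENNReal.ofReal (2 * Real.arccos x) := by
  rcases lt_or_ge 1 x with hx | hx
  · have hempty : {θ : ℝ | x ≤ Real.cos θ} = ∅ :=
      eq_empty_of_forall_notMem fun θ hθ => hx.not_ge (hθ.trans (Real.cos_le_one θ))
    simp [hempty, Real.arccos_of_one_le hx.le]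
  have hle_cos {θ : ℝ} (hθ : |θ| ≤ Real.pi) : x ≤ Real.cos θ ↔ |θ| ≤ Real.arccos x := by
    rw [← Real.cos_abs]
    refine ⟨fun h => Real.arccos_cos (abs_nonneg θ) hθ ▸ Real.antitone_arccos h, fun h => ?_⟩
    rcases le_total (-1) x with hx' | hx'
    · rw [← Real.cos_arccos hx' hx]
      exact Real.cos_le_cos_of_nonneg_of_le_pi (abs_nonneg θ) (Real.arccos_le_pi x) h
    · exact hx'.trans (Real.neg_one_le_cos _)
  have hinter : {θ | x ≤ Real.cos θ} ∩ Icc (-Real.pi) Real.pi =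
      Icc (-Real.arccos x) (Real.arccos x) := by
    ext θ
    rw [mem_inter_iff, mem_ofPred_eq, mem_Icc, mem_Icc, ← abs_le, ← abs_le]
    exact ⟨fun h => (hle_cos h.2).1 h.1,
      fun h => ⟨(hle_cos (h.trans (Real.arccos_le_pi x))).2 h, h.trans (Real.arccos_le_pi x)⟩⟩
  rw [restrict_Ioo_eq_restrict_Icc, Measure.restrict_apply
    (measurableSet_le measurable_const Real.measurable_cos), hinter, Real.volume_Icc,
    sub_neg_eq_add, two_mul]

lemma continuous_besselI0 : Continuous besselI0 := by
  unfold besselI0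
  exact continuous_const.mul
    (intervalIntegral.continuous_parametric_intervalIntegral_of_continuous' (by fun_prop) _ _)

lemma besselI0_nonneg (x : ℝ) : 0 ≤ besselI0 x :=
  mul_nonneg (by positivity)
    (intervalIntegral.integral_nonneg Real.pi_pos.le fun θ _ => (Real.exp_pos _).le)

lemma lintegral_exp_mul_cos (x : ℝ) :
    ∫⁻ θ in Ioo (-Real.pi) Real.pi, ENNReal.ofReal (Real.exp (x * Real.cos θ)) =
      ENNReal.ofReal (2 * Real.pi * besselI0 x) := by
  have hcont : Continuous fun θ : ℝ => Real.exp (x * Real.cos θ) := by fun_prop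
  have heven : ∫ θ in (-Real.pi)..0, Real.exp (x * Real.cos θ) =
      ∫ θ in (0 : ℝ)..Real.pi, Real.exp (x * Real.cos θ) := by
    simpa using (intervalIntegral.integral_comp_neg (a := 0) (b := Real.pi)
      fun θ => Real.exp (x * Real.cos θ)).symm
  rw [← ofReal_integral_eq_lintegral_ofReal
    ((hcont.continuousOn.integrableOn_compact isCompact_Icc).mono_set Ioo_subset_Icc_self)
    (Eventually.of_forall fun θ => (Real.exp_pos _).le), ← integral_Ioc_eq_integral_Ioo,
    ← intervalIntegral.integral_of_le (neg_le_self Real.pi_pos.le),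
    ← intervalIntegral.integral_add_adjacent_intervals (b := 0) (hcont.intervalIntegrable _ _)
      (hcont.intervalIntegrable _ _), heven, besselI0, ← two_mul]
  field_simp

/-! ### Distances of users to the origin -/

lemma unitStep_nonneg (x : ℝ) : 0 ≤ unitStep x := by
  unfold unitStep; split_ifs <;> norm_num

@[fun_prop]
lemma measurable_unitStep : Measurable unitStep :=
  Measurable.ite measurableSet_Ici measurable_const measurable_const

/-- Under `ν`, the distance to the origin has the density `f` on `(0, ∞)`. The values of `f` outside
of that interval are irrelevant. -/
structure HasNormDensity (ν : Measure Plane) (f : ℝ → ℝ) : Prop where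
  measurable : Measurable f
  nonneg : ∀ g, 0 < g → 0 ≤ f g
  lintegral_norm : ∀ h : ℝ → ℝ≥0∞, Measurable h →
    ∫⁻ u, h ‖u‖ ∂ν = ∫⁻ g in Ioi (0 : ℝ), h g * ENNReal.ofReal (f g)

namespace HasNormDensity

variable {ν : Measure Plane} {f : ℝ → ℝ}

lemma ae_nonneg (hf : HasNormDensity ν f) : ∀ᵐ g ∂(volume.restrict (Ioi (0 : ℝ))), 0 ≤ f g :=
  (ae_restrict_mem measurableSet_Ioi).mono hf.nonneg

lemma integrableOn [IsFiniteMeasure ν] (hf : HasNormDensity ν f) : IntegrableOn f (Ioi 0) := by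
  refine ⟨hf.measurable.aestronglyMeasurable, ?_⟩
  rw [hasFiniteIntegral_iff_ofReal hf.ae_nonneg]
  have hmass := hf.lintegral_norm (fun _ => 1) measurable_const
  simp only [lintegral_const, one_mul] at hmass
  exact hmass ▸ measure_lt_top ν univ

end HasNormDensity

namespace ClusterShape

/-- The density of the position of a user, as a function of the distance to the cluster centre. -/
def radial : ClusterShape → ℝ → ℝ
  | .thomas σ _, r => 1 / (2 * Real.pi * σ ^ 2) * Real.exp (-(r ^ 2 / (2 * σ ^ 2)))
  | .matern R _, r => 1 / (Real.pi * R ^ 2) * unitStep (R - r)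

lemma density_eq_radial_norm (c : ClusterShape) (u : Plane) : c.density u = c.radial ‖u‖ := by
  cases c <;> rfl

lemma radial_nonneg (c : ClusterShape) (r : ℝ) : 0 ≤ c.radial r := by
  cases c with
  | thomas σ hσ => unfold radial; positivity
  | matern R hR => exact mul_nonneg (by positivity) (unitStep_nonneg _)

@[fun_prop]
lemma measurable_radial (c : ClusterShape) : Measurable c.radial := by
  cases c <;> (unfold radial; fun_prop)

lemma lintegral_density_thomas {σ : ℝ} (hσ : 0 < σ) :
    ∫⁻ u, ENNReal.ofReal ((thomas σ hσ).density u) = 1 := by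
  have hb : 0 < 1 / (2 * σ ^ 2) := by positivity
  have hgauss := GaussianFourier.integral_rexp_neg_mul_sq_norm (V := Plane) hb
  have hint : Integrable fun v : Plane => Real.exp (-(1 / (2 * σ ^ 2)) * ‖v‖ ^ 2) :=
    not_imp_comm.1 integral_undef (hgauss ▸ by positivity)
  have hdensity (u : Plane) : (thomas σ hσ).density u =
      1 / (2 * Real.pi * σ ^ 2) * Real.exp (-(1 / (2 * σ ^ 2)) * ‖u‖ ^ 2) := by
    simp only [density]; congr 2; ring
  simp only [hdensity]
  rw [← ofReal_integral_eq_lintegral_ofReal (hint.const_mul _)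
    (Eventually.of_forall fun u => by positivity), integral_const_mul, hgauss]
  simp
  field_simp

lemma lintegral_density_matern {R : ℝ} (hR : 0 < R) :
    ∫⁻ u, ENNReal.ofReal ((matern R hR).density u) = 1 := by
  have hdensity (u : Plane) : ENNReal.ofReal ((matern R hR).density u) =
      (Metric.closedBall (0 : Plane) R).indicator
        (fun _ => ENNReal.ofReal (1 / (Real.pi * R ^ 2))) u := by
    by_cases hu : ‖u‖ ≤ R <;> simp [density, unitStep, hu]
  simp only [hdensity]
  rw [lintegral_indicator measurableSet_closedBall, setLIntegral_const,
    EuclideanSpace.volume_closedBall_fin_two, ← ENNReal.ofReal_pow hR.le,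
    ← ENNReal.ofReal_mul (by positivity), ← ENNReal.ofReal_mul (by positivity),
    ENNReal.ofReal_eq_one]
  field_simp

instance (c : ClusterShape) : IsProbabilityMeasure c.law where
  measure_univ := by
    rw [law, withDensity_apply _ MeasurableSet.univ, setLIntegral_univ]
    cases c with
    | thomas σ hσ => exact lintegral_density_thomas hσ
    | matern R hR => exact lintegral_density_matern hR

lemma lintegral_law_norm_add (c : ClusterShape) {h : ℝ → ℝ≥0∞} (hh : Measurable h) (v : Plane) :
    ∫⁻ u, h ‖v + u‖ ∂c.law = ∫⁻ g in Ioi (0 : ℝ), h g * (ENNReal.ofReal g *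
      ∫⁻ θ in Ioo (-Real.pi) Real.pi, ENNReal.ofReal (c.radial (thirdSide g ‖v‖ θ))) := by
  have hradial : Measurable fun u : Plane => ENNReal.ofReal (c.radial ‖u‖) := by fun_prop
  simp only [law, density_eq_radial_norm]
  rw [lintegral_withDensity_eq_lintegral_mul _ hradial (by fun_prop)]
  calc ∫⁻ u : Plane, ENNReal.ofReal (c.radial ‖u‖) * h ‖v + u‖
      = ∫⁻ u : Plane, h ‖v + u‖ * ENNReal.ofReal (c.radial ‖v + u - v‖) := by
        simp only [add_sub_cancel_left, mul_comm]
    _ = ∫⁻ x : Plane, h ‖x‖ * ENNReal.ofReal (c.radial ‖x - v‖) :=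
        lintegral_add_left_eq_self (fun x : Plane => h ‖x‖ * ENNReal.ofReal (c.radial ‖x - v‖)) v
    _ = _ := by
        rw [lintegral_norm_mul_norm_sub hh (ρ := fun r => ENNReal.ofReal (c.radial r))
          (by fun_prop)]
        exact lintegral_congr fun g => by ring

lemma pdfIntra_eq_radial (c : ClusterShape) (g : ℝ) :
    c.pdfIntra g = 2 * Real.pi * g * c.radial g := by
  cases c <;> (simp only [radial, pdfIntra]; field_simp)

lemma hasNormDensity_law (c : ClusterShape) : HasNormDensity c.law c.pdfIntra where
  measurable := by
    simp only [funext c.pdfIntra_eq_radial]; fun_prop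
  nonneg g hg := by
    have := c.radial_nonneg g
    rw [c.pdfIntra_eq_radial]; positivity
  lintegral_norm h hh := by
    have hpolar := c.lintegral_law_norm_add hh 0
    simp only [zero_add, norm_zero] at hpolar
    rw [hpolar]
    refine setLIntegral_congr_fun measurableSet_Ioi fun g (hg : 0 < g) => ?_
    simp only [thirdSide_zero hg.le, lintegral_Ioo_neg_pi_pi_const]
    rw [← ENNReal.ofReal_mul (by positivity), ← ENNReal.ofReal_mul hg.le, c.pdfIntra_eq_radial]
    congr 2; ring

lemma pdfInter_nonneg (c : ClusterShape) {g : ℝ} (hg : 0 ≤ g) (q : ℝ) : 0 ≤ c.pdfInter g q := by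
  cases c with
  | thomas σ hσ => exact mul_nonneg (by positivity) (besselI0_nonneg _)
  | matern R hR =>
    have := Real.arccos_nonneg ((g ^ 2 + q ^ 2 - R ^ 2) / (2 * g * q))
    have := unitStep_nonneg (g - |R - q|)
    have := unitStep_nonneg (R + q - g)
    have := unitStep_nonneg (R - q - g)
    unfold pdfInter; positivity

lemma measurable_pdfInter (c : ClusterShape) (q : ℝ) : Measurable fun g => c.pdfInter g q := by
  have := continuous_besselI0.measurable
  have := Real.continuous_arccos.measurable
  cases c <;> (unfold pdfInter; fun_prop)

lemma ofReal_pdfInter_thomas {σ : ℝ} (hσ : 0 < σ) {g : ℝ} (hg : 0 ≤ g) (q : ℝ) :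
    ENNReal.ofReal ((thomas σ hσ).pdfInter g q) = ENNReal.ofReal g *
      ∫⁻ θ in Ioo (-Real.pi) Real.pi,
        ENNReal.ofReal ((thomas σ hσ).radial (thirdSide g q θ)) := by
  have hradial (θ : ℝ) : ENNReal.ofReal ((thomas σ hσ).radial (thirdSide g q θ)) =
      ENNReal.ofReal (1 / (2 * Real.pi * σ ^ 2) * Real.exp (-((g ^ 2 + q ^ 2) / (2 * σ ^ 2)))) *
        ENNReal.ofReal (Real.exp (g * q / σ ^ 2 * Real.cos θ)) := by
    rw [← ENNReal.ofReal_mul (by positivity), mul_assoc, ← Real.exp_add, radial, sq_thirdSide]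
    congr 3; field_simp; ring
  simp only [hradial]
  rw [lintegral_const_mul _ (by fun_prop), lintegral_exp_mul_cos,
    ← ENNReal.ofReal_mul (by positivity), ← ENNReal.ofReal_mul hg, pdfInter]
  congr 1
  field_simp

lemma pdfInter_matern {R : ℝ} (hR : 0 < R) {g q : ℝ} (hg : 0 < g) (hq : 0 < q)
    (hgR : g ≠ |R - q|) : (matern R hR).pdfInter g q =
      2 * g / (Real.pi * R ^ 2) * Real.arccos ((g ^ 2 + q ^ 2 - R ^ 2) / (2 * g * q)) := by
  have hgq : 0 < 2 * g * q := by positivity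
  set x := (g ^ 2 + q ^ 2 - R ^ 2) / (2 * g * q) with hx
  have harccos_zero (h : R ^ 2 ≤ (g - q) ^ 2) : Real.arccos x = 0 :=
    Real.arccos_of_one_le (by rw [hx, le_div_iff₀ hgq]; nlinarith)
  have harccos_pi (h : (g + q) ^ 2 ≤ R ^ 2) : Real.arccos x = Real.pi :=
    Real.arccos_of_le_neg_one (by rw [hx, div_le_iff₀ hgq]; nlinarith)
  simp only [pdfInter, unitStep, sub_nonneg]
  rcases lt_or_gt_of_ne hgR with hlt | hgt
  · rw [if_neg (not_le.2 hlt)]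
    rcases le_total R q with hRq | hqR
    · rw [abs_of_nonpos (by linarith)] at hlt
      rw [if_neg (not_le.2 (by linarith : R - q < g)), harccos_zero (by nlinarith)]
      simp
    · rw [abs_of_nonneg (by linarith)] at hlt
      rw [if_pos hlt.le, harccos_pi (by nlinarith)]
      field_simp
      ring
  · have hRqg : R - q < g := (le_abs_self _).trans_lt hgt
    rw [if_pos hgt.le, if_neg (not_le.2 hRqg)]
    by_cases hgRq : g ≤ R + q
    · rw [if_pos hgRq]; simp [hx]
    · rw [if_neg hgRq, harccos_zero (by nlinarith)]; simp

lemma ofReal_pdfInter_matern {R : ℝ} (hR : 0 < R) {g q : ℝ} (hg : 0 < g) (hq : 0 < q)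
    (hgR : g ≠ |R - q|) :
    ENNReal.ofReal ((matern R hR).pdfInter g q) = ENNReal.ofReal g *
      ∫⁻ θ in Ioo (-Real.pi) Real.pi,
        ENNReal.ofReal ((matern R hR).radial (thirdSide g q θ)) := by
  set x := (g ^ 2 + q ^ 2 - R ^ 2) / (2 * g * q)
  have hradial (θ : ℝ) : ENNReal.ofReal ((matern R hR).radial (thirdSide g q θ)) =
      {θ | x ≤ Real.cos θ}.indicator (fun _ => ENNReal.ofReal (1 / (Real.pi * R ^ 2))) θ := by
    have hmem : thirdSide g q θ ≤ R ↔ θ ∈ {θ | x ≤ Real.cos θ} := thirdSide_le_iff hg hq hR.le θ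
    by_cases hθ : θ ∈ {θ | x ≤ Real.cos θ}
    · rw [indicator_of_mem hθ, radial, unitStep, if_pos (sub_nonneg.2 (hmem.2 hθ)), mul_one]
    · rw [indicator_of_notMem hθ, radial, unitStep, if_neg (mt (hmem.1 ∘ sub_nonneg.1) hθ),
        mul_zero, ENNReal.ofReal_zero]
  simp only [hradial]
  rw [lintegral_indicator_const (measurableSet_le measurable_const Real.measurable_cos),
    volume_restrict_setOf_le_cos, ← ENNReal.ofReal_mul (by positivity),
    ← ENNReal.ofReal_mul hg.le, pdfInter_matern hR hg hq hgR]
  congr 1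
  ring

lemma hasNormDensity_map_add (c : ClusterShape) {v : Plane} (hv : v ≠ 0) :
    HasNormDensity (c.law.map (v + ·)) fun g => c.pdfInter g ‖v‖ where
  measurable := c.measurable_pdfInter _
  nonneg _ hg := c.pdfInter_nonneg hg.le _
  lintegral_norm h hh := by
    rw [lintegral_map (by fun_prop) (by fun_prop), c.lintegral_law_norm_add hh v]
    cases c with
    | thomas σ hσ =>
      refine setLIntegral_congr_fun measurableSet_Ioi fun g (hg : 0 < g) => ?_
      rw [ofReal_pdfInter_thomas hσ hg.le]
    | matern R hR =>
      have hne : ∀ᵐ g ∂(volume.restrict (Ioi (0 : ℝ))), g ≠ |R - ‖v‖| :=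
        ae_restrict_of_ae (Measure.ae_ne volume _)
      refine lintegral_congr_ae ?_
      filter_upwards [hne, ae_restrict_mem measurableSet_Ioi] with g hgR hg
      rw [ofReal_pdfInter_matern hR hg (norm_pos_iff.2 hv) hgR]

end ClusterShape

/-! ### Marks and links -/

lemma Link.sum_eq {M : Type*} [AddCommMonoid M] (f : Link → M) : ∑ κ, f κ = f .los + f .nlos :=
  Finset.sum_pair (by decide)

namespace Mark

/-- The mark with given components; it transports `Setting.markLaw` to a measure on marks. -/
def ofProd (p : Plane × ℝ × ℝ × (Link → ℝ)) : Mark := ⟨p.1, p.2.1, p.2.2.1, p.2.2.2⟩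

lemma measurable_toProd : Measurable toProd := comap_measurable _

lemma measurable_ofProd : Measurable ofProd :=
  measurable_comap_iff.2 measurable_id

@[fun_prop]
lemma measurable_offset : Measurable offset := measurable_toProd.fst

@[fun_prop]
lemma measurable_unif : Measurable unif := measurable_toProd.snd.fst

@[fun_prop]
lemma measurable_gain : Measurable gain := measurable_toProd.snd.snd.fst

@[fun_prop]
lemma measurable_fading : Measurable fading := measurable_toProd.snd.snd.snd

end Mark

lemma beam_mem_Icc {a e : ℝ} (ha : a ∈ Icc 0 (2 * Real.pi)) (he : e ∈ Icc 0 Real.pi) :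
    a / (2 * Real.pi) * (e / Real.pi) ∈ Icc (0 : ℝ) 1 :=
  have hpi := Real.pi_pos
  unitInterval.mul_mem
    ⟨div_nonneg ha.1 (by positivity), div_le_one_of_le₀ ha.2 (by positivity)⟩
    ⟨div_nonneg he.1 hpi.le, div_le_one_of_le₀ he.2 hpi.le⟩

lemma lintegral_Icc_zero_one_ite_le {p : ℝ} (hp : p ∈ Icc (0 : ℝ) 1) (a b : ℝ≥0∞) :
    ∫⁻ t in Icc (0 : ℝ) 1, (if t ≤ p then a else b) =
      ENNReal.ofReal p * a + ENNReal.ofReal (1 - p) * b := by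
  have hdisj : Disjoint (Icc 0 p) (Ioc p 1) :=
    Set.disjoint_left.2 fun t ht ht' => ht'.1.not_ge ht.2
  rw [← Icc_union_Ioc_eq_Icc hp.1 hp.2, lintegral_union measurableSet_Ioc hdisj,
    setLIntegral_congr_fun measurableSet_Icc (g := fun _ => a) fun t ht => if_pos ht.2,
    setLIntegral_congr_fun measurableSet_Ioc (g := fun _ => b) fun t ht => if_neg ht.1.not_ge]
  simp [mul_comm]

instance : IsProbabilityMeasure (volume.restrict (Icc (0 : ℝ) 1)) := ⟨by simp⟩

namespace Setting

variable (S : Setting)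

lemma beamT_mem : S.beamT ∈ Icc (0 : ℝ) 1 := beam_mem_Icc S.thetaTa_mem S.thetaTe_mem

lemma beamR_mem : S.beamR ∈ Icc (0 : ℝ) 1 := beam_mem_Icc S.thetaRa_mem S.thetaRe_mem

lemma gainProb_nonneg (i : Fin 4) : 0 ≤ S.gainProb i := by
  obtain ⟨hT, hT'⟩ := S.beamT_mem
  obtain ⟨hR, hR'⟩ := S.beamR_mem
  rw [← sub_nonneg] at hT' hR'
  fin_cases i
  exacts [mul_nonneg hT hR, mul_nonneg hT' hR, mul_nonneg hT hR', mul_nonneg hT' hR']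

lemma sum_gainProb : ∑ i, S.gainProb i = 1 := by
  simp only [gainProb, Fin.sum_univ_four, Matrix.cons_val]
  ring

lemma gainValue_nonneg (i : Fin 4) : 0 ≤ S.gainValue i := by
  fin_cases i
  exacts [mul_nonneg S.Mt_pos.le S.Mr_pos.le, mul_nonneg S.mt_nonneg S.Mr_pos.le,
    mul_nonneg S.Mt_pos.le S.mr_nonneg, mul_nonneg S.mt_nonneg S.mr_nonneg]

lemma gainValue_zero_pos : 0 < S.gainValue 0 := mul_pos S.Mt_pos S.Mr_pos

lemma lintegral_gainLaw (f : ℝ → ℝ≥0∞) :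
    ∫⁻ a, f a ∂S.gainLaw = ∑ i, ENNReal.ofReal (S.gainProb i) * f (S.gainValue i) := by
  simp only [gainLaw, lintegral_finsetSum_measure, lintegral_smul_measure, lintegral_dirac,
    smul_eq_mul]

instance : IsProbabilityMeasure S.gainLaw where
  measure_univ := by
    rw [← lintegral_one, lintegral_gainLaw]
    simp only [mul_one]
    rw [← ENNReal.ofReal_sum_of_nonneg fun i _ => S.gainProb_nonneg i, S.sum_gainProb,
      ENNReal.ofReal_one]

lemma Nak_cast_pos (κ : Link) : (0 : ℝ) < S.Nak κ := Nat.cast_pos.2 (S.Nak_pos κ)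

instance (κ : Link) : IsProbabilityMeasure (gammaMeasure (S.Nak κ) (S.Nak κ)) :=
  isProbabilityMeasure_gammaMeasure (S.Nak_cast_pos κ) (S.Nak_cast_pos κ)

instance : IsProbabilityMeasure S.fadingLaw := by
  unfold fadingLaw
  infer_instance

lemma lintegral_fadingLaw_eval (κ : Link) {f : ℝ → ℝ≥0∞} (hf : Measurable f) :
    ∫⁻ b, f (b κ) ∂S.fadingLaw = ∫⁻ x, f x ∂(gammaMeasure (S.Nak κ) (S.Nak κ)) :=
  (measurePreserving_eval (fun κ => gammaMeasure (S.Nak κ) (S.Nak κ)) κ).lintegral_comp hf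

instance : IsProbabilityMeasure S.markLaw := by
  unfold markLaw
  infer_instance

/-- The law of a mark, as a measure on marks. -/
def markDist : Measure Mark := S.markLaw.map Mark.ofProd

instance : IsProbabilityMeasure S.markDist :=
  Measure.isProbabilityMeasure_map Mark.measurable_ofProd.aemeasurable

lemma losProb_mem (γ : ℕ) : S.losProb γ ∈ Icc (0 : ℝ) 1 := by
  unfold losProb
  split_ifs
  · exact ⟨zero_le_one, le_rfl⟩
  · have hfactor {x : ℝ} (hx : 0 ≤ x) : 1 - Real.exp (-x) ∈ Icc (0 : ℝ) 1 :=
      ⟨one_sub_exp_neg_nonneg hx, sub_le_self _ (Real.exp_pos _).le⟩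
    exact ⟨Finset.prod_nonneg fun n _ => (hfactor (by positivity)).1,
      Finset.prod_le_one (fun n _ => (hfactor (by positivity)).1)
        fun n _ => (hfactor (by positivity)).2⟩

lemma linkProb_nonneg (κ : Link) (γ : ℕ) : 0 ≤ S.linkProb κ γ := by
  cases κ
  · exact (S.losProb_mem γ).1
  · exact sub_nonneg.2 (S.losProb_mem γ).2

lemma linkProb_los_add_nlos (γ : ℕ) : S.linkProb .los γ + S.linkProb .nlos γ = 1 :=
  add_sub_cancel _ _

/-- The blockage cell of the distance `r`. -/
def cellIndex (r : ℝ) : ℕ := ⌊r * S.rootBeta⌋₊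

@[fun_prop]
lemma measurable_cellIndex : Measurable S.cellIndex := by
  unfold cellIndex
  fun_prop

@[fun_prop]
lemma measurable_linkProb_cellIndex (κ : Link) :
    Measurable fun r => S.linkProb κ (S.cellIndex r) :=
  (measurable_of_countable (S.linkProb κ)).comp S.measurable_cellIndex

lemma dh_pos : 0 < S.dh := abs_pos.2 (sub_ne_zero.2 S.heights_ne)

lemma pathLoss_pos (κ : Link) (r : ℝ) : 0 < S.pathLoss κ r := by
  have := S.dh_pos
  exact div_pos (S.C_pos κ) (Real.sqrt_pos.2 (Real.rpow_pos_of_pos (by positivity) _))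

@[fun_prop]
lemma measurable_pathLoss (κ : Link) : Measurable (S.pathLoss κ) := by
  unfold pathLoss
  fun_prop

lemma measurable_comp_linkState {α β : Type*} [MeasurableSpace α] [MeasurableSpace β]
    {r : α → ℝ} {m : α → Mark} {F : Link → α → β} (hr : Measurable r) (hm : Measurable m)
    (hF : ∀ κ, Measurable (F κ)) : Measurable fun x => F (S.linkState (r x) (m x)) x := by
  have hite : (fun x => F (S.linkState (r x) (m x)) x) = fun x =>
      if (m x).unif ≤ S.linkProb .los (S.cellIndex (r x)) then F .los x else F .nlos x := by
    ext x
    unfold linkState cellIndex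
    split_ifs <;> rfl
  rw [hite]
  exact Measurable.ite (measurableSet_le (by fun_prop)
    ((S.measurable_linkProb_cellIndex .los).comp hr)) (hF _) (hF _)

lemma lintegral_markDist {G : Mark → ℝ≥0∞} (hG : Measurable G) :
    ∫⁻ m, G m ∂S.markDist =
      ∫⁻ u, (∫⁻ t in Icc (0 : ℝ) 1, ∫⁻ a, ∫⁻ b, G ⟨u, t, a, b⟩
        ∂S.fadingLaw ∂S.gainLaw) ∂S.shape.law := by
  have hG' : Measurable fun p => G (Mark.ofProd p) := hG.comp Mark.measurable_ofProd
  rw [markDist, lintegral_map hG Mark.measurable_ofProd, markLaw,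
    lintegral_prod _ hG'.aemeasurable]
  refine lintegral_congr fun u => ?_
  have hGu := hG'.comp (measurable_prodMk_left (x := u))
  refine (lintegral_prod _ hGu.aemeasurable).trans (lintegral_congr fun t => ?_)
  exact lintegral_prod _ (hGu.comp measurable_prodMk_left).aemeasurable

lemma lintegral_markDist_linkState (v : Plane) {F : Link → Plane × ℝ × (Link → ℝ) → ℝ≥0∞}
    (hF : ∀ κ, Measurable (F κ)) :
    ∫⁻ m, F (S.linkState ‖v + m.offset‖ m) (m.offset, m.gain, m.fading) ∂S.markDist =
      ∫⁻ u, ∑ κ, ENNReal.ofReal (S.linkProb κ (S.cellIndex ‖v + u‖)) *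
        ∫⁻ a, ∫⁻ b, F κ (u, a, b) ∂S.fadingLaw ∂S.gainLaw ∂S.shape.law := by
  have hmeas : Measurable fun m : Mark =>
      F (S.linkState ‖v + m.offset‖ m) (m.offset, m.gain, m.fading) :=
    S.measurable_comp_linkState (F := fun κ m => F κ (m.offset, m.gain, m.fading)) (by fun_prop)
      measurable_id fun κ => (hF κ).comp (by fun_prop)
  rw [S.lintegral_markDist hmeas]
  refine lintegral_congr fun u => ?_
  have hstate (t a : ℝ) (b : Link → ℝ) : S.linkState ‖v + u‖ ⟨u, t, a, b⟩ =
      if t ≤ S.linkProb .los (S.cellIndex ‖v + u‖) then .los else .nlos := rfl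
  rw [Link.sum_eq]
  refine Eq.trans (lintegral_congr fun t => ?_) (lintegral_Icc_zero_one_ite_le
    (p := S.linkProb .los (S.cellIndex ‖v + u‖)) (S.losProb_mem _) _ _)
  simp only [hstate]
  split_ifs <;> rfl

end Setting

/-! ### Blockage cells -/

namespace Setting

variable (S : Setting)

lemma rootBeta_pos : 0 < S.rootBeta := Real.sqrt_pos.2 (mul_pos S.betaA_pos S.betaB_pos)

lemma cell_nonneg (γ : ℕ) : 0 ≤ S.cell γ := div_nonneg (Nat.cast_nonneg _) S.rootBeta_pos.le

lemma cell_le_cell_succ (γ : ℕ) : S.cell γ ≤ S.cell (γ + 1) :=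
  div_le_div_of_nonneg_right (Nat.cast_le.2 γ.le_succ) S.rootBeta_pos.le

lemma mem_Ico_cell_iff {γ : ℕ} {w : ℝ} :
    w ∈ Ico (S.cell γ) (S.cell (γ + 1)) ↔ 0 ≤ w ∧ S.cellIndex w = γ := by
  have hindex (hw : 0 ≤ w) :
      w ∈ Ico (S.cell γ) (S.cell (γ + 1)) ↔ S.cellIndex w = γ := by
    rw [mem_Ico, cell, cell, div_le_iff₀ S.rootBeta_pos, lt_div_iff₀ S.rootBeta_pos, cellIndex,
      Nat.floor_eq_iff (mul_nonneg hw S.rootBeta_pos.le), Nat.cast_add_one]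
  exact ⟨fun h => have hw := (S.cell_nonneg γ).trans h.1; ⟨hw, (hindex hw).1 h⟩,
    fun h => (hindex h.1).2 h.2⟩

lemma iUnion_Ico_cell : ⋃ γ, Ico (S.cell γ) (S.cell (γ + 1)) = Ici 0 := by
  ext w
  simp only [mem_iUnion, mem_Ico_cell_iff, mem_Ici, exists_and_left, exists_eq', and_true]

lemma pairwise_disjoint_Ico_cell :
    Pairwise (Function.onFun Disjoint fun γ => Ico (S.cell γ) (S.cell (γ + 1))) :=
  fun _ _ hne => Set.disjoint_left.2 fun _ hw hw' =>
    hne ((S.mem_Ico_cell_iff.1 hw).2.symm.trans (S.mem_Ico_cell_iff.1 hw').2)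

lemma eqOn_cellIndex {β : Type*} (F : ℕ → ℝ → β) (γ : ℕ) :
    EqOn (fun w => F (S.cellIndex w) w) (F γ) (Ico (S.cell γ) (S.cell (γ + 1))) := by
  intro w hw
  simp only [(S.mem_Ico_cell_iff.1 hw).2]

lemma intervalIntegrable_cell {F : ℕ → ℝ → ℝ}
    (hF : IntegrableOn (fun w => F (S.cellIndex w) w) (Ioi 0)) (γ : ℕ) :
    IntervalIntegrable (F γ) volume (S.cell γ) (S.cell (γ + 1)) := by
  rw [← integrableOn_Ici_iff_integrableOn_Ioi, ← S.iUnion_Ico_cell] at hF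
  rw [intervalIntegrable_iff_integrableOn_Ico_of_le (S.cell_le_cell_succ γ)]
  exact (hF.mono_set (subset_iUnion (fun γ => Ico (S.cell γ) (S.cell (γ + 1))) γ)).congr_fun
    (S.eqOn_cellIndex F γ) measurableSet_Ico

lemma hasSum_integral_cell {F : ℕ → ℝ → ℝ}
    (hF : IntegrableOn (fun w => F (S.cellIndex w) w) (Ioi 0)) :
    HasSum (fun γ => ∫ w in S.cell γ..S.cell (γ + 1), F γ w)
      (∫ w in Ioi 0, F (S.cellIndex w) w) := by
  have hcell (γ : ℕ) : ∫ w in S.cell γ..S.cell (γ + 1), F γ w =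
      ∫ w in Ico (S.cell γ) (S.cell (γ + 1)), F (S.cellIndex w) w := by
    rw [setIntegral_congr_fun measurableSet_Ico (S.eqOn_cellIndex F γ),
      intervalIntegral.integral_of_le (S.cell_le_cell_succ γ), integral_Ico_eq_integral_Ioo,
      integral_Ioc_eq_integral_Ioo]
  simp only [hcell]
  rw [← integrableOn_Ici_iff_integrableOn_Ioi, ← S.iUnion_Ico_cell] at hF
  rw [← integral_Ici_eq_integral_Ioi, ← S.iUnion_Ico_cell]
  exact hasSum_integral_iUnion (fun _ => measurableSet_Ico) S.pairwise_disjoint_Ico_cell hF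

/-! ### Laplace transform of one interfering link -/

/-- `Λ^L + Λ^N`, the Laplace transform of the channel gain of an interfering link at distance `w`
in the blockage cell `γ`. -/
def linkLaplace (γ : ℕ) (w s : ℝ) : ℝ := S.Lam .los γ w s + S.Lam .nlos γ w s

lemma lintegral_eexpNeg_fading (κ : Link) {c : ℝ} (hc : 0 ≤ c) :
    ∫⁻ b, eexpNeg (ENNReal.ofReal (c * b κ)) ∂S.fadingLaw =
      ENNReal.ofReal (((1 + c / S.Nak κ) ^ S.Nak κ)⁻¹) := by
  rw [S.lintegral_fadingLaw_eval κ (f := fun x => eexpNeg (ENNReal.ofReal (c * x)))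
    (by fun_prop), ← Real.rpow_natCast,
    ← lintegral_exp_gammaMeasure (S.Nak_cast_pos κ) (S.Nak_cast_pos κ) hc]
  refine lintegral_congr_ae ?_
  filter_upwards [ae_nonneg_gammaMeasure (S.Nak κ) (S.Nak κ)] with x hx
  rw [eexpNeg_ofReal (mul_nonneg hc hx)]

lemma ofReal_Lam (κ : Link) (γ : ℕ) (r : ℝ) {s : ℝ} (hs : 0 ≤ s) :
    ENNReal.ofReal (S.Lam κ γ r s) = ENNReal.ofReal (S.linkProb κ γ) *
      ∫⁻ a, ∫⁻ b, eexpNeg (ENNReal.ofReal s * ENNReal.ofReal (S.pathLoss κ r * a * b κ))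
        ∂S.fadingLaw ∂S.gainLaw := by
  have hc (i : Fin 4) : 0 ≤ s * (S.pathLoss κ r * S.gainValue i) :=
    mul_nonneg hs (mul_nonneg (S.pathLoss_pos κ r).le (S.gainValue_nonneg i))
  have hscale (i : Fin 4) : s * S.C κ * S.gainValue i /
      ((S.Nak κ : ℝ) * Real.sqrt ((r ^ 2 + S.dh ^ 2) ^ S.alpha κ)) =
      s * (S.pathLoss κ r * S.gainValue i) / S.Nak κ := by
    rw [pathLoss]
    ring
  have hfactor (i : Fin 4) :
      0 ≤ ((1 + s * (S.pathLoss κ r * S.gainValue i) / S.Nak κ) ^ S.Nak κ)⁻¹ := by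
    have := hc i
    positivity
  simp only [Lam, hscale]
  rw [ENNReal.ofReal_mul (S.linkProb_nonneg κ γ), S.lintegral_gainLaw,
    ENNReal.ofReal_sum_of_nonneg fun i _ => mul_nonneg (S.gainProb_nonneg i) (hfactor i)]
  congr 1
  refine Finset.sum_congr rfl fun i _ => ?_
  rw [ENNReal.ofReal_mul (S.gainProb_nonneg i), ← S.lintegral_eexpNeg_fading κ (hc i)]
  simp only [← ENNReal.ofReal_mul hs, mul_assoc]

lemma Lam_nonneg (κ : Link) (γ : ℕ) (w : ℝ) {s : ℝ} (hs : 0 ≤ s) : 0 ≤ S.Lam κ γ w s := by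
  refine mul_nonneg (S.linkProb_nonneg κ γ) (Finset.sum_nonneg fun i _ => ?_)
  have := (S.C_pos κ).le
  have := S.gainValue_nonneg i
  have := S.gainProb_nonneg i
  positivity

lemma Lam_le_linkProb (κ : Link) (γ : ℕ) (w : ℝ) {s : ℝ} (hs : 0 ≤ s) :
    S.Lam κ γ w s ≤ S.linkProb κ γ := by
  rw [← ENNReal.ofReal_le_ofReal_iff (S.linkProb_nonneg κ γ), S.ofReal_Lam κ γ w hs]
  refine mul_le_of_le_one_right zero_le ?_
  calc _ ≤ ∫⁻ _, ∫⁻ _, 1 ∂S.fadingLaw ∂S.gainLaw :=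
        lintegral_mono fun a => lintegral_mono fun b => eexpNeg_le_one _
    _ = 1 := by simp only [lintegral_one, measure_univ]

lemma linkLaplace_nonneg (γ : ℕ) (w : ℝ) {s : ℝ} (hs : 0 ≤ s) : 0 ≤ S.linkLaplace γ w s :=
  add_nonneg (S.Lam_nonneg _ γ w hs) (S.Lam_nonneg _ γ w hs)

lemma linkLaplace_le_one (γ : ℕ) (w : ℝ) {s : ℝ} (hs : 0 ≤ s) : S.linkLaplace γ w s ≤ 1 :=
  (add_le_add (S.Lam_le_linkProb _ γ w hs) (S.Lam_le_linkProb _ γ w hs)).trans_eq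
    (S.linkProb_los_add_nlos γ)

lemma measurable_linkLaplace_cellIndex (s : ℝ) :
    Measurable fun w => S.linkLaplace (S.cellIndex w) w s := by
  unfold linkLaplace Lam
  fun_prop

lemma lintegral_linkLaplace_norm {s : ℝ} (hs : 0 ≤ s) {ν : Measure Plane} [IsFiniteMeasure ν]
    {f : ℝ → ℝ} (hν : HasNormDensity ν f) :
    ∫⁻ u, ENNReal.ofReal (S.linkLaplace (S.cellIndex ‖u‖) ‖u‖ s) ∂ν =
      ENNReal.ofReal (∑' γ : ℕ, ∫ w in S.cell γ..S.cell (γ + 1), S.linkLaplace γ w s * f w) := by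
  have hint : IntegrableOn (fun w => S.linkLaplace (S.cellIndex w) w s * f w) (Ioi 0) := by
    refine Integrable.bdd_mul (c := 1) hν.integrableOn
      (S.measurable_linkLaplace_cellIndex s).aestronglyMeasurable (.of_forall fun w => ?_)
    rw [Real.norm_of_nonneg (S.linkLaplace_nonneg _ _ hs)]
    exact S.linkLaplace_le_one _ _ hs
  rw [hν.lintegral_norm (fun w => ENNReal.ofReal (S.linkLaplace (S.cellIndex w) w s))
    (S.measurable_linkLaplace_cellIndex s).ennreal_ofReal,
    (S.hasSum_integral_cell (F := fun γ w => S.linkLaplace γ w s * f w) hint).tsum_eq,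
    ofReal_integral_eq_lintegral_ofReal hint]
  · exact lintegral_congr fun w => by
      rw [ENNReal.ofReal_mul (S.linkLaplace_nonneg _ _ hs), mul_comm]
  · filter_upwards [hν.ae_nonneg] with w hw
    exact mul_nonneg (S.linkLaplace_nonneg _ _ hs) hw

/-- The Laplace transform of the interference of a user whose cluster is centred at `v`. -/
def userLaplace (s : ℝ) (v : Plane) : ℝ≥0∞ :=
  ∫⁻ m, eexpNeg (ENNReal.ofReal s * ENNReal.ofReal (S.channelGain (v + m.offset) m)) ∂S.markDist

lemma userLaplace_eq_lintegral_law {s : ℝ} (hs : 0 ≤ s) (v : Plane) :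
    S.userLaplace s v = ∫⁻ u, ENNReal.ofReal
      (S.linkLaplace (S.cellIndex ‖v + u‖) ‖v + u‖ s) ∂S.shape.law := by
  refine (S.lintegral_markDist_linkState v (F := fun κ p => eexpNeg (ENNReal.ofReal s *
    ENNReal.ofReal (S.pathLoss κ ‖v + p.1‖ * p.2.1 * p.2.2 κ))) fun κ => by fun_prop).trans
    (lintegral_congr fun u => ?_)
  rw [Link.sum_eq, linkLaplace,
    ENNReal.ofReal_add (S.Lam_nonneg _ _ _ hs) (S.Lam_nonneg _ _ _ hs), S.ofReal_Lam _ _ _ hs,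
    S.ofReal_Lam _ _ _ hs]

lemma userLaplace_zero {s : ℝ} (hs : 0 ≤ s) : S.userLaplace s 0 = ENNReal.ofReal (S.Oa s) := by
  rw [S.userLaplace_eq_lintegral_law hs]
  simp only [zero_add]
  exact S.lintegral_linkLaplace_norm hs S.shape.hasNormDensity_law

lemma userLaplace_of_ne_zero {s : ℝ} (hs : 0 ≤ s) {v : Plane} (hv : v ≠ 0) :
    S.userLaplace s v = ENNReal.ofReal (S.Oe s ‖v‖) := by
  have hadd : Measurable fun u : Plane => v + u := measurable_const_add v
  have := Measure.isProbabilityMeasure_map (μ := S.shape.law) hadd.aemeasurable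
  rw [S.userLaplace_eq_lintegral_law hs, ← lintegral_map (μ := S.shape.law)
    (f := fun x => ENNReal.ofReal (S.linkLaplace (S.cellIndex ‖x‖) ‖x‖ s))
    ((S.measurable_linkLaplace_cellIndex s).comp measurable_norm).ennreal_ofReal hadd]
  exact S.lintegral_linkLaplace_norm hs (S.shape.hasNormDensity_map_add hv)

end Setting

/-! ### Numbers of users -/

namespace UserNumber

lemma lintegral_pow_law (n : UserNumber) {x : ℝ} (hx : 0 ≤ x) :
    ∫⁻ k, ENNReal.ofReal x ^ k ∂n.law = ENNReal.ofReal (Setting.clusterFactor n x) := by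
  cases n with
  | fixed N hN => rw [law, lintegral_dirac, Setting.clusterFactor, ENNReal.ofReal_pow hx]
  | random n hn =>
    rw [law, lintegral_pow_poissonMeasure _ hx, Setting.clusterFactor,
      Real.coe_toNNReal n (zero_le_one.trans hn)]

lemma measurable_clusterFactor (n : UserNumber) : Measurable (Setting.clusterFactor n) := by
  cases n <;> unfold Setting.clusterFactor <;> fun_prop

lemma clusterFactor_pos (n : UserNumber) {x : ℝ} (hx : 0 < x) :
    0 < Setting.clusterFactor n x := by
  cases n with
  | fixed N hN => exact pow_pos hx N
  | random n hn => exact Real.exp_pos _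

lemma clusterFactor_le_one (n : UserNumber) {x : ℝ} (hx : 0 ≤ x) (hx1 : x ≤ 1) :
    Setting.clusterFactor n x ≤ 1 := by
  cases n with
  | fixed N hN => exact pow_le_one₀ hx hx1
  | random n hn =>
    exact Real.exp_le_one_iff.2
      (neg_nonpos.2 (mul_nonneg (zero_le_one.trans hn) (sub_nonneg.2 hx1)))

lemma typicalLaw_zero (n : UserNumber) : n.typicalLaw {0} = 0 := by
  cases n with
  | fixed N hN =>
    rw [typicalLaw, Measure.dirac_apply,
      indicator_of_notMem (show N ∉ ({0} : Set ℕ) from Nat.one_le_iff_ne_zero.1 hN)]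
  | random n hn =>
    rw [typicalLaw, Measure.map_apply (measurable_of_countable _) (measurableSet_singleton 0),
      preimage_singleton_eq_empty.2 fun ⟨k, hk⟩ => k.succ_ne_zero hk, measure_empty]

/-- The generating function of the number of interferers in the corresponding cluster; `Setting.La`
is its value at `Setting.Oa`. -/
def intraFactor : UserNumber → ℝ → ℝ
  | .fixed N _, x => x ^ (N - 1)
  | .random n _, x => Real.exp (-((n - 1) * (1 - x)))

lemma lintegral_pow_typicalLaw (n : UserNumber) {x : ℝ} (hx : 0 ≤ x) :
    ∫⁻ m, ENNReal.ofReal x ^ (m - 1) ∂n.typicalLaw = ENNReal.ofReal (n.intraFactor x) := by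
  cases n with
  | fixed N hN => rw [typicalLaw, lintegral_dirac, intraFactor, ENNReal.ofReal_pow hx]
  | random n hn =>
    rw [typicalLaw, lintegral_map (measurable_of_countable _) (measurable_of_countable _)]
    simp only [Nat.add_sub_cancel]
    rw [lintegral_pow_poissonMeasure _ hx, intraFactor, Real.coe_toNNReal _ (sub_nonneg.2 hn)]

end UserNumber

/-! ### Laplace transform of one interfering cluster -/

namespace Setting

variable (S : Setting)

lemma La_eq_intraFactor (s : ℝ) : S.La s = S.number.intraFactor (S.Oa s) := by
  unfold La UserNumber.intraFactor
  cases S.number <;> rfl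

/-- The received power from a user with mark `m` in a cluster centred at `v`. -/
def userPower (v : Plane) (m : Mark) : ℝ≥0∞ := ENNReal.ofReal (S.channelGain (v + m.offset) m)

@[fun_prop]
lemma measurable_userPower {α : Type*} [MeasurableSpace α] {v : α → Plane} {m : α → Mark}
    (hv : Measurable v) (hm : Measurable m) : Measurable fun x => S.userPower (v x) (m x) :=
  ENNReal.measurable_ofReal.comp <| S.measurable_comp_linkState
    (r := fun x => ‖v x + (m x).offset‖)
    (F := fun κ x => S.pathLoss κ ‖v x + (m x).offset‖ * (m x).gain * (m x).fading κ)
    (by fun_prop) hm fun κ => by fun_prop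

lemma measurable_userLaplace (s : ℝ) : Measurable (S.userLaplace s) := by
  have hjoint : Measurable fun p : Plane × Mark =>
      eexpNeg (ENNReal.ofReal s * S.userPower p.1 p.2) := by fun_prop
  exact hjoint.lintegral_prod_right'

lemma userLaplace_le_one (s : ℝ) (v : Plane) : S.userLaplace s v ≤ 1 :=
  (lintegral_mono fun _ => eexpNeg_le_one _).trans_eq (by rw [lintegral_one, measure_univ])

lemma userLaplace_ne_top (s : ℝ) (v : Plane) : S.userLaplace s v ≠ ∞ :=
  ne_top_of_le_ne_top ENNReal.one_ne_top (S.userLaplace_le_one s v)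

lemma userLaplace_pos (s : ℝ) (v : Plane) : 0 < S.userLaplace s v := by
  have hmeas : Measurable fun m : Mark => eexpNeg (ENNReal.ofReal s * S.userPower v m) := by
    fun_prop
  have hsupp : Function.support (fun m => eexpNeg (ENNReal.ofReal s * S.userPower v m)) = univ :=
    Function.support_eq_univ fun m =>
      (eexpNeg_pos (ENNReal.mul_ne_top ENNReal.ofReal_ne_top ENNReal.ofReal_ne_top)).ne'
  refine (lintegral_pos_iff_support hmeas).2 ?_
  rw [hsupp, measure_univ]
  exact one_pos

lemma toReal_userLaplace_pos (s : ℝ) (v : Plane) : 0 < (S.userLaplace s v).toReal :=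
  ENNReal.toReal_pos (S.userLaplace_pos s v).ne' (S.userLaplace_ne_top s v)

lemma toReal_userLaplace_le_one (s : ℝ) (v : Plane) : (S.userLaplace s v).toReal ≤ 1 :=
  ENNReal.toReal_mono ENNReal.one_ne_top (S.userLaplace_le_one s v)

lemma Oa_pos {s : ℝ} (hs : 0 ≤ s) : 0 < S.Oa s := by
  have hpos := S.userLaplace_pos s 0
  rwa [S.userLaplace_zero hs, ENNReal.ofReal_pos] at hpos

lemma toReal_userLaplace_of_ne_zero {s : ℝ} (hs : 0 ≤ s) {v : Plane} (hv : v ≠ 0) :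
    (S.userLaplace s v).toReal = S.Oe s ‖v‖ := by
  have hpos := S.userLaplace_pos s v
  rw [S.userLaplace_of_ne_zero hs hv] at hpos ⊢
  exact ENNReal.toReal_ofReal (ENNReal.ofReal_pos.1 hpos).le

/-- The Laplace transform of the interference of a cluster centred at `v`. -/
def clusterLaplace (t : ℝ) (v : Plane) : ℝ :=
  clusterFactor S.number (S.userLaplace t v).toReal

lemma clusterLaplace_pos (t : ℝ) (v : Plane) : 0 < S.clusterLaplace t v :=
  S.number.clusterFactor_pos (S.toReal_userLaplace_pos t v)

lemma clusterLaplace_le_one (t : ℝ) (v : Plane) : S.clusterLaplace t v ≤ 1 :=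
  S.number.clusterFactor_le_one (S.toReal_userLaplace_pos t v).le (S.toReal_userLaplace_le_one t v)

@[fun_prop]
lemma measurable_clusterLaplace (t : ℝ) : Measurable (S.clusterLaplace t) :=
  S.number.measurable_clusterFactor.comp (S.measurable_userLaplace t).ennreal_toReal

lemma lintegral_pow_userLaplace (t : ℝ) (v : Plane) :
    ∫⁻ k, S.userLaplace t v ^ k ∂S.number.law = ENNReal.ofReal (S.clusterLaplace t v) := by
  rw [clusterLaplace, ← S.number.lintegral_pow_law (S.toReal_userLaplace_pos t v).le,
    ENNReal.ofReal_toReal (S.userLaplace_ne_top t v)]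

lemma clusterLaplace_of_ne_zero {t : ℝ} (ht : 0 ≤ t) {v : Plane} (hv : v ≠ 0) :
    S.clusterLaplace t v = clusterFactor S.number (S.Oe t ‖v‖) := by
  rw [clusterLaplace, S.toReal_userLaplace_of_ne_zero ht hv]

lemma clusterLaplace_congr_norm {t : ℝ} (ht : 0 ≤ t) {v w : Plane} (h : ‖v‖ = ‖w‖) :
    S.clusterLaplace t v = S.clusterLaplace t w := by
  rcases eq_or_ne v 0 with rfl | hv
  · rw [norm_zero, eq_comm, norm_eq_zero] at h
    rw [h]
  · have hw : w ≠ 0 := norm_ne_zero_iff.1 (h ▸ norm_ne_zero_iff.2 hv)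
    rw [S.clusterLaplace_of_ne_zero ht hv, S.clusterLaplace_of_ne_zero ht hw, h]

lemma lintegral_one_sub_clusterLaplace {t : ℝ} (ht : 0 ≤ t) :
    ∫⁻ v : Plane, ENNReal.ofReal (1 - S.clusterLaplace t v) =
      ENNReal.ofReal (2 * Real.pi) * ∫⁻ q in Ioi (0 : ℝ),
        ENNReal.ofReal ((1 - clusterFactor S.number (S.Oe t q)) * q) := by
  obtain ⟨e, he⟩ : ∃ e : Plane, ‖e‖ = 1 := exists_norm_eq Plane zero_le_one
  have hnorm {q : ℝ} (hq : 0 ≤ q) : ‖q • e‖ = q := by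
    rw [norm_smul, he, mul_one, Real.norm_of_nonneg hq]
  have hray (v : Plane) : S.clusterLaplace t v = S.clusterLaplace t (‖v‖ • e) :=
    S.clusterLaplace_congr_norm ht (hnorm (norm_nonneg v)).symm
  rw [lintegral_congr fun v => by rw [hray v],
    lintegral_norm (h := fun q => ENNReal.ofReal (1 - S.clusterLaplace t (q • e))) (by fun_prop),
    ← lintegral_const_mul' _ _ ENNReal.ofReal_ne_top]
  refine setLIntegral_congr_fun measurableSet_Ioi fun q (hq : 0 < q) => ?_
  have hqe : q • e ≠ 0 := norm_ne_zero_iff.1 ((hnorm hq.le).symm ▸ hq.ne')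
  rw [S.clusterLaplace_of_ne_zero ht hqe, hnorm hq.le, ← ENNReal.ofReal_mul (by positivity),
    ← ENNReal.ofReal_mul (by positivity)]
  ring_nf

lemma ofReal_Le {t : ℝ} (ht : 0 ≤ t) :
    ENNReal.ofReal (S.Le t) = eexpNeg (ENNReal.ofReal S.lam *
      ∫⁻ v : Plane, ENNReal.ofReal (1 - S.clusterLaplace t v)) := by
  rw [S.lintegral_one_sub_clusterLaplace ht, ← mul_assoc, ← ENNReal.ofReal_mul S.lam_pos.le,
    mul_comm S.lam]
  rfl

end Setting

/-! ### Independence of the components of the network -/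

section Independence

variable {Ω : Type*} [MeasurableSpace Ω] {μ : Measure Ω}

lemma lintegral_comp_prodMk_of_indepFun [IsFiniteMeasure μ] {α β : Type*} [MeasurableSpace α]
    [MeasurableSpace β] {X : Ω → α} {Y : Ω → β} (hX : Measurable X) (hY : Measurable Y)
    (h : IndepFun X Y μ) {G : α × β → ℝ≥0∞} (hG : Measurable G) :
    ∫⁻ ω, G (X ω, Y ω) ∂μ = ∫⁻ ω, ∫⁻ ω', G (X ω, Y ω') ∂μ ∂μ := by
  have hlaw := (indepFun_iff_map_prod_eq_prod_map_map hX.aemeasurable hY.aemeasurable).1 h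
  rw [← lintegral_map hG (hX.prodMk hY), hlaw, lintegral_prod _ hG.aemeasurable,
    lintegral_map hG.lintegral_prod_right' hX]
  exact lintegral_congr fun ω => lintegral_map (hG.comp measurable_prodMk_left) hY

lemma lintegral_prod_of_iIndepFun {ι β : Type*} [MeasurableSpace β] {X : ι → Ω → β}
    (h : iIndepFun X μ) (hX : ∀ i, Measurable (X i)) {ν : Measure β} (hν : ∀ i, μ.map (X i) = ν)
    {f : ι → β → ℝ≥0∞} (hf : ∀ i, Measurable (f i)) (s : Finset ι) :
    ∫⁻ ω, ∏ i ∈ s, f i (X i ω) ∂μ = ∏ i ∈ s, ∫⁻ b, f i b ∂ν := by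
  rw [lintegral_prod_eq_prod_lintegral_of_indepFun s (fun i ω => f i (X i ω)) (h.comp f hf)
    fun i => (hf i).comp (hX i)]
  refine Finset.prod_congr rfl fun i _ => ?_
  rw [← hν i, lintegral_map (hf i) (hX i)]

lemma indepFun_update_of_iIndepFun {ι β : Type*} [DecidableEq ι] [MeasurableSpace β]
    {X : ι → Ω → β} (h : iIndepFun X μ) (hX : ∀ i, Measurable (X i)) (i : ι) (b : β) :
    IndepFun (X i) (fun ω => Function.update (fun j => X j ω) i b) μ := by
  have hcompl := indep_iSup_of_disjoint (fun j => (hX j).comap_le) h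
    (S := {i}) (T := {i}ᶜ) disjoint_compl_right
  refine indep_of_indep_of_le_left (indep_of_indep_of_le_right hcompl ?_)
    (le_iSup₂_of_le i rfl le_rfl)
  rw [← measurable_iff_comap_le]
  refine @measurable_pi_lambda _ _ _ (_) _ _ fun j => ?_
  rcases eq_or_ne j i with rfl | hj
  · simp only [Function.update_self, measurable_const]
  · simp only [Function.update_of_ne hj]
    exact (comap_measurable (X j)).mono (le_iSup₂_of_le j hj le_rfl) le_rfl

end Independence

lemma measurable_sum_finset_comp {α κ ι : Type*} [MeasurableSpace α] [MeasurableSpace κ]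
    [Countable κ] [MeasurableSingletonClass κ] {k : α → κ} (hk : Measurable k) (s : κ → Finset ι)
    {f : ι → α → ℝ≥0∞} (hf : ∀ i, Measurable (f i)) :
    Measurable fun x => ∑ i ∈ s (k x), f i x := by
  have hjoint : Measurable fun p : κ × α => ∑ i ∈ s p.1, f i p.2 :=
    measurable_from_prod_countable_right fun k => Finset.measurable_fun_sum (s k) fun i _ => hf i
  exact hjoint.comp (hk.prodMk measurable_id)

lemma measurable_eval_comp {α κ ι β : Type*} [MeasurableSpace α] [MeasurableSpace κ] [Countable κ]
    [MeasurableSingletonClass κ] [MeasurableSpace β] {k : α → κ} (hk : Measurable k) (e : κ → ι)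
    {x : α → ι → β} (hx : Measurable x) : Measurable fun a => x a (e (k a)) := by
  have hjoint : Measurable fun p : κ × (ι → β) => p.2 (e p.1) :=
    measurable_from_prod_countable_right fun k => measurable_pi_apply (e k)
  exact hjoint.comp (hk.prodMk hx)

/-- The independent components of a network: the positions of the other UAVs, the number of users
and the transmitting user of the corresponding cluster, the numbers of users of the other clusters,
and the marks of all users. -/
abbrev Components := (ℕ → Plane) × (ℕ × ℕ) × (ℕ → ℕ) × (Option ℕ × ℕ → Mark)

/-- The centre of a cluster, `none` being the corresponding one. -/
def clusterCentre (v : ℕ → Plane) : Option ℕ → Plane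
  | none => 0
  | some i => v i

/-- The interfering users of a cluster. -/
def interferers (p : ℕ × ℕ) (c : ℕ → ℕ) : Option ℕ → Finset ℕ
  | none => (Finset.range p.1).erase p.2
  | some i => Finset.range (c i)

namespace Setting

variable (S : Setting)

/-- The interference caused by one cluster, as a function of the components of the network. -/
def clusterInterference (k : Option ℕ) : Components → ℝ≥0∞
  | (v, p, c, x) => ∑ j ∈ interferers p c k, S.userPower (clusterCentre v k) (x (k, j))

@[fun_prop]
lemma measurable_clusterInterference (k : Option ℕ) : Measurable (S.clusterInterference k) := by
  have hcentre : Measurable fun z : Components => clusterCentre z.1 k := by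
    cases k <;> unfold clusterCentre <;> fun_prop
  have hpower (j : ℕ) : Measurable fun z : Components =>
      S.userPower (clusterCentre z.1 k) (z.2.2.2 (k, j)) :=
    S.measurable_userPower hcentre (by fun_prop)
  cases k with
  | none =>
    exact measurable_sum_finset_comp (k := fun z : Components => z.2.1) (by fun_prop)
      (fun p => (Finset.range p.1).erase p.2) hpower
  | some i =>
    exact measurable_sum_finset_comp (k := fun z : Components => z.2.2.1 i) (by fun_prop)
      Finset.range hpower

lemma clusterInterference_update (k : Option ℕ) (v : ℕ → Plane) (p : ℕ × ℕ) (c : ℕ → ℕ)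
    (x : Option ℕ × ℕ → Mark) (m : Mark) :
    S.clusterInterference k (v, p, c, Function.update x (none, p.2) m) =
      S.clusterInterference k (v, p, c, x) := by
  refine Finset.sum_congr rfl fun j hj => ?_
  have hne : (k, j) ≠ (none, p.2) := by
    rintro ⟨⟩
    exact Finset.notMem_erase _ _ hj
  rw [Function.update_of_ne hne]

end Setting

namespace Network

variable {S : Setting} {Ω : Type*} [MeasurableSpace Ω] {μ : Measure Ω} (net : Network S μ)

/-- The marks of all users, as one random variable. -/
def marks (ω : Ω) (l : Option ℕ × ℕ) : Mark := net.mark l ω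

/-- The random components of the network. -/
def components (ω : Ω) : Components :=
  (fun i => net.uav i ω, (net.count₀ ω, net.selected ω), fun i => net.count i ω, net.marks ω)

lemma measurable_marks : Measurable net.marks := measurable_pi_lambda _ net.mark_measurable

lemma measurable_components : Measurable net.components :=
  (measurable_pi_lambda _ net.uav_poisson.measurable).prodMk
    ((net.count₀_measurable.prodMk net.selected_measurable).prodMk
      ((measurable_pi_lambda _ net.count_measurable).prodMk net.measurable_marks))

lemma measurable_mark₀ : Measurable net.mark₀ :=
  measurable_eval_comp net.selected_measurable (fun k => (none, k)) net.measurable_marks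

lemma intra_eq_clusterInterference (ω : Ω) :
    net.intra ω = S.clusterInterference none (net.components ω) :=
  Finset.sum_congr rfl fun j _ => by
    simp only [Setting.userPower, clusterCentre, zero_add, marks]

lemma inter_eq_tsum_clusterInterference (ω : Ω) :
    net.inter ω = ∑' i, S.clusterInterference (some i) (net.components ω) := rfl

lemma measurable_intra : Measurable net.intra := by
  rw [funext net.intra_eq_clusterInterference]
  exact (S.measurable_clusterInterference none).comp net.measurable_components

lemma measurable_inter : Measurable net.inter := by
  rw [funext net.inter_eq_tsum_clusterInterference]
  exact Measurable.tsum fun i =>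
    (S.measurable_clusterInterference (some i)).comp net.measurable_components

lemma map_mark (l : Option ℕ × ℕ) : μ.map (net.mark l) = S.markDist := by
  rw [Setting.markDist, ← net.mark_law l]
  exact (Measure.map_map Mark.measurable_ofProd
    (Mark.measurable_toProd.comp (net.mark_measurable l))).symm

lemma lintegral_components [IsProbabilityMeasure μ] {G : Components → ℝ≥0∞} (hG : Measurable G) :
    ∫⁻ ω, G (net.components ω) ∂μ =
      ∫⁻ ω₁, ∫⁻ ω₂, ∫⁻ ω₃, ∫⁻ ω₄, G (fun i => net.uav i ω₁, (net.count₀ ω₂, net.selected ω₂),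
        fun i => net.count i ω₃, net.marks ω₄) ∂μ ∂μ ∂μ ∂μ := by
  have hselection := net.count₀_measurable.prodMk net.selected_measurable
  have hcounts := measurable_pi_lambda _ net.count_measurable
  have hcounts_marks := hcounts.prodMk net.measurable_marks
  refine (lintegral_comp_prodMk_of_indepFun (measurable_pi_lambda _ net.uav_poisson.measurable)
    (hselection.prodMk hcounts_marks) net.uav_indep hG).trans (lintegral_congr fun ω₁ => ?_)
  refine (lintegral_comp_prodMk_of_indepFun hselection hcounts_marks net.selection_indep
    (hG.comp measurable_prodMk_left)).trans (lintegral_congr fun ω₂ => ?_)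
  exact lintegral_comp_prodMk_of_indepFun hcounts net.measurable_marks net.count_mark_indep
    (hG.comp (measurable_prodMk_left.comp measurable_prodMk_left))

lemma lintegral_mark_update [IsProbabilityMeasure μ] (l : Option ℕ × ℕ) (m₀ : Mark)
    {G : Mark × (Option ℕ × ℕ → Mark) → ℝ≥0∞} (hG : Measurable G) :
    ∫⁻ ω, G (net.mark l ω, Function.update (net.marks ω) l m₀) ∂μ =
      ∫⁻ ω, ∫⁻ m, G (m, Function.update (net.marks ω) l m₀) ∂S.markDist ∂μ := by
  refine (lintegral_comp_prodMk_of_indepFun (measurable_update_left.comp net.measurable_marks)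
    (net.mark_measurable l) (indepFun_update_of_iIndepFun net.mark_indep net.mark_measurable l
      m₀).symm (hG.comp measurable_swap)).trans (lintegral_congr fun ω => ?_)
  rw [← net.map_mark l, lintegral_map (by fun_prop) (net.mark_measurable l)]
  rfl

/-- The total interference. -/
def interference (ω : Ω) : ℝ≥0∞ := net.intra ω + net.inter ω

@[fun_prop]
lemma measurable_interference : Measurable net.interference :=
  net.measurable_intra.add net.measurable_inter

-- The interference does not depend on the mark of the transmitting user, which can therefore be
-- resampled.
theorem lintegral_mark₀_interference [IsProbabilityMeasure μ] {G : Mark × ℝ≥0∞ → ℝ≥0∞}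
    (hG : Measurable G) :
    ∫⁻ ω, G (net.mark₀ ω, net.interference ω) ∂μ =
      ∫⁻ ω, ∫⁻ m, G (m, net.interference ω) ∂S.markDist ∂μ := by
  let I (z : Components) : ℝ≥0∞ :=
    S.clusterInterference none z + ∑' i, S.clusterInterference (some i) z
  have hI : Measurable I := (S.measurable_clusterInterference none).add
    (Measurable.tsum fun i => S.measurable_clusterInterference (some i))
  have hinterference (ω : Ω) : net.interference ω = I (net.components ω) := by
    rw [interference, intra_eq_clusterInterference, inter_eq_tsum_clusterInterference]
  have hI_update (v : ℕ → Plane) (p : ℕ × ℕ) (c : ℕ → ℕ) (x : Option ℕ × ℕ → Mark) (m : Mark) :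
      I (v, p, c, Function.update x (none, p.2) m) = I (v, p, c, x) := by
    simp only [I, S.clusterInterference_update]
  have hmark₀ : Measurable fun z : Components => z.2.2.2 (none, z.2.1.2) :=
    measurable_eval_comp (k := fun z : Components => z.2.1.2) (by fun_prop) (fun k => (none, k))
      (by fun_prop)
  simp_rw [hinterference]
  refine (net.lintegral_components (hG.comp (hmark₀.prodMk hI))).trans
    (Eq.trans ?_ (net.lintegral_components (hG.lintegral_prod_left'.comp hI)).symm)
  refine lintegral_congr fun ω₁ => lintegral_congr fun ω₂ => lintegral_congr fun ω₃ => ?_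
  have hresample := net.lintegral_mark_update (none, net.selected ω₂) (Mark.ofProd 0)
    (G := fun q => G (q.1, I (fun i => net.uav i ω₁, (net.count₀ ω₂, net.selected ω₂),
      fun i => net.count i ω₃, q.2))) (hG.comp (by fun_prop))
  simp only [hI_update] at hresample
  exact hresample

end Network

/-! ### Laplace transforms of the interference -/

lemma tendsto_lintegral_eexpNeg_sum {Ω : Type*} [MeasurableSpace Ω] {μ : Measure Ω}
    [IsFiniteMeasure μ] {y : Ω → ℝ≥0∞} (hy : Measurable y) {f : ℕ → Ω → ℝ≥0∞}
    (hf : ∀ i, Measurable (f i)) :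
    Tendsto (fun n => ∫⁻ ω, eexpNeg (y ω + ∑ i ∈ Finset.range n, f i ω) ∂μ) atTop
      (𝓝 (∫⁻ ω, eexpNeg (y ω + ∑' i, f i ω) ∂μ)) := by
  refine tendsto_lintegral_of_dominated_convergence (fun _ => 1) (fun n => by fun_prop)
    (fun n => .of_forall fun ω => eexpNeg_le_one _) (by simp) (.of_forall fun ω => ?_)
  exact (continuous_eexpNeg.tendsto _).comp
    (tendsto_const_nhds.add ENNReal.summable.hasSum.tendsto_sum_nat)

namespace Network

variable {S : Setting} {Ω : Type*} [MeasurableSpace Ω] {μ : Measure Ω} (net : Network S μ)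

lemma lintegral_eexpNeg_sum_clusterInterference (r : Option ℕ → ℝ) (K : Finset (Option ℕ))
    (v : ℕ → Plane) (p : ℕ × ℕ) (c : ℕ → ℕ) :
    ∫⁻ ω, eexpNeg (∑ k ∈ K, ENNReal.ofReal (r k) *
        S.clusterInterference k (v, p, c, net.marks ω)) ∂μ =
      ∏ k ∈ K, S.userLaplace (r k) (clusterCentre v k) ^ (interferers p c k).card := by
  let user (q : Σ _ : Option ℕ, ℕ) : Option ℕ × ℕ := (q.1, q.2)
  have huser : Function.Injective user := (Equiv.sigmaEquivProd (Option ℕ) ℕ).injective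
  have hprod (ω : Ω) : eexpNeg (∑ k ∈ K, ENNReal.ofReal (r k) *
      S.clusterInterference k (v, p, c, net.marks ω)) =
      ∏ q ∈ K.sigma (interferers p c), eexpNeg (ENNReal.ofReal (r q.1) *
        S.userPower (clusterCentre v q.1) (net.mark (user q) ω)) := by
    simp only [Setting.clusterInterference, Finset.mul_sum, eexpNeg_sum, Finset.prod_sigma]
    rfl
  simp_rw [hprod]
  rw [lintegral_prod_of_iIndepFun (X := fun q => net.mark (user q))
    (net.mark_indep.precomp huser) (fun q => net.mark_measurable (user q))
    (fun q => net.map_mark (user q))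
    (f := fun q m => eexpNeg (ENNReal.ofReal (r q.1) * S.userPower (clusterCentre v q.1) m))
    (by fun_prop), Finset.prod_sigma]
  exact Finset.prod_congr rfl fun k _ => Finset.prod_eq_pow_card fun _ _ => rfl

lemma lintegral_prod_pow_count (t : ℝ) (v : ℕ → Plane) (n : ℕ) :
    ∫⁻ ω, ∏ i ∈ Finset.range n, S.userLaplace t (v i) ^ net.count i ω ∂μ =
      ∏ i ∈ Finset.range n, ENNReal.ofReal (S.clusterLaplace t (v i)) := by
  rw [lintegral_prod_of_iIndepFun net.count_indep net.count_measurable net.count_law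
    (f := fun i k => S.userLaplace t (v i) ^ k) fun i => measurable_of_countable _]
  simp_rw [S.lintegral_pow_userLaplace]

lemma ae_selected_lt_count₀ : ∀ᵐ ω ∂μ, net.selected ω < net.count₀ ω := by
  have hall : ∀ᵐ ω ∂μ, ∀ m k : ℕ, ¬k < m → ¬(net.count₀ ω = m ∧ net.selected ω = k) := by
    refine ae_all_iff.2 fun m => ae_all_iff.2 fun k => ?_
    by_cases hk : k < m
    · exact .of_forall fun ω h => absurd hk h
    · have hnull := net.selection_law m k
      rw [if_neg hk] at hnull
      exact (measure_eq_zero_iff_ae_notMem.1 hnull).mono fun ω h _ => h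
  filter_upwards [hall] with ω hω
  by_contra hlt
  exact hω _ _ hlt ⟨rfl, rfl⟩

lemma map_count₀ : μ.map net.count₀ = S.number.typicalLaw := by
  refine Measure.ext_of_singleton fun m => ?_
  have hunion : net.count₀ ⁻¹' {m} = ⋃ k, {ω | net.count₀ ω = m ∧ net.selected ω = k} := by
    ext ω
    simp only [mem_preimage, mem_singleton_iff, mem_iUnion, mem_ofPred_eq, exists_and_left,
      exists_eq', and_true]
  have hmeas (k : ℕ) : MeasurableSet {ω | net.count₀ ω = m ∧ net.selected ω = k} :=
    (net.count₀_measurable (measurableSet_singleton m)).inter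
      (net.selected_measurable (measurableSet_singleton k))
  have hdisj : Pairwise (Function.onFun Disjoint
      fun k => {ω | net.count₀ ω = m ∧ net.selected ω = k}) := fun k l hkl =>
    disjoint_left.2 fun ω hk hl => hkl (hk.2.symm.trans hl.2)
  rw [Measure.map_apply net.count₀_measurable (measurableSet_singleton m), hunion,
    measure_iUnion hdisj hmeas]
  simp_rw [net.selection_law m]
  rw [tsum_eq_sum (s := Finset.range m) fun k hk => if_neg (by simpa using hk),
    Finset.sum_congr rfl fun k hk => if_pos (Finset.mem_range.1 hk), Finset.sum_const,
    Finset.card_range, nsmul_eq_mul]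
  rcases eq_or_ne m 0 with rfl | hm
  · rw [S.number.typicalLaw_zero, Nat.cast_zero, zero_mul]
  · exact ENNReal.mul_div_cancel (Nat.cast_ne_zero.2 hm) (ENNReal.natCast_ne_top m)

lemma lintegral_pow_card_interferers_none {x : ℝ} (hx : 0 ≤ x) (c : ℕ → ℕ) :
    ∫⁻ ω, ENNReal.ofReal x ^ (interferers (net.count₀ ω, net.selected ω) c none).card ∂μ =
      ENNReal.ofReal (S.number.intraFactor x) := by
  rw [← S.number.lintegral_pow_typicalLaw hx, ← net.map_count₀,
    lintegral_map (measurable_of_countable _) net.count₀_measurable]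
  refine lintegral_congr_ae (net.ae_selected_lt_count₀.mono fun ω hω => ?_)
  simp only [interferers, Finset.card_erase_of_mem (Finset.mem_range.2 hω), Finset.card_range]

variable [IsProbabilityMeasure μ]

lemma lintegral_eexpNeg_truncated {s : ℝ} (hs : 0 ≤ s) (t : ℝ) (n : ℕ) :
    ∫⁻ ω, eexpNeg (ENNReal.ofReal s * S.clusterInterference none (net.components ω) +
        ∑ i ∈ Finset.range n,
          ENNReal.ofReal t * S.clusterInterference (some i) (net.components ω)) ∂μ =
      ENNReal.ofReal (S.La s) *
        ∫⁻ ω, ∏ i ∈ Finset.range n, ENNReal.ofReal (S.clusterLaplace t (net.uav i ω)) ∂μ := by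
  have hmarks (v : ℕ → Plane) (p : ℕ × ℕ) (c : ℕ → ℕ) :
      ∫⁻ ω, eexpNeg (ENNReal.ofReal s * S.clusterInterference none (v, p, c, net.marks ω) +
          ∑ i ∈ Finset.range n,
            ENNReal.ofReal t * S.clusterInterference (some i) (v, p, c, net.marks ω)) ∂μ =
        S.userLaplace s 0 ^ (interferers p c none).card *
          ∏ i ∈ Finset.range n, S.userLaplace t (v i) ^ c i := by
    have h := net.lintegral_eexpNeg_sum_clusterInterference (fun k => k.elim s fun _ => t)
      (Finset.range n).insertNone v p c
    simpa only [Finset.sum_insertNone, Finset.prod_insertNone, clusterCentre, interferers,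
      Option.elim, Finset.card_range] using h
  rw [net.lintegral_components (G := fun z => eexpNeg (ENNReal.ofReal s *
    S.clusterInterference none z + ∑ i ∈ Finset.range n, ENNReal.ofReal t *
      S.clusterInterference (some i) z)) (by fun_prop)]
  simp_rw [hmarks, S.userLaplace_zero hs]
  have hcounts (v : ℕ → Plane) (p : ℕ × ℕ) :
      ∫⁻ ω, ENNReal.ofReal (S.Oa s) ^ (interferers p (fun i => net.count i ω) none).card *
          ∏ i ∈ Finset.range n, S.userLaplace t (v i) ^ net.count i ω ∂μ =
        ENNReal.ofReal (S.Oa s) ^ (interferers p 0 none).card *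
          ∏ i ∈ Finset.range n, ENNReal.ofReal (S.clusterLaplace t (v i)) := by
    rw [← net.lintegral_prod_pow_count, ← lintegral_const_mul' _ _
      (ENNReal.pow_ne_top ENNReal.ofReal_ne_top)]
    rfl
  simp_rw [hcounts]
  rw [← lintegral_const_mul' _ _ ENNReal.ofReal_ne_top]
  refine lintegral_congr fun ω => ?_
  rw [lintegral_mul_const' _ _ (ENNReal.prod_ne_top fun _ _ => ENNReal.ofReal_ne_top),
    net.lintegral_pow_card_interferers_none (S.Oa_pos hs).le, S.La_eq_intraFactor]

lemma tendsto_lintegral_prod_clusterLaplace {t : ℝ} (ht : 0 ≤ t) :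
    Tendsto (fun n => ∫⁻ ω, ∏ i ∈ Finset.range n,
      ENNReal.ofReal (S.clusterLaplace t (net.uav i ω)) ∂μ) atTop
        (𝓝 (ENNReal.ofReal (S.Le t))) := by
  let f (v : Plane) : ℝ≥0∞ := ENNReal.ofReal (-Real.log (S.clusterLaplace t v))
  have hf : Measurable f := by fun_prop
  have hexp (v : Plane) : eexpNeg (f v) = ENNReal.ofReal (S.clusterLaplace t v) := by
    rw [eexpNeg_ofReal (neg_nonneg.2 (Real.log_nonpos (S.clusterLaplace_pos t v).le
      (S.clusterLaplace_le_one t v))), neg_neg, Real.exp_log (S.clusterLaplace_pos t v)]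
  have hLe : ENNReal.ofReal (S.Le t) = ∫⁻ ω, eexpNeg (∑' i, f (net.uav i ω)) ∂μ := by
    rw [net.uav_poisson.lintegral_eexpNeg_tsum hf, S.ofReal_Le ht]
    simp_rw [hexp, ENNReal.ofReal_sub 1 (S.clusterLaplace_pos t _).le, ENNReal.ofReal_one]
  rw [hLe]
  simp_rw [← hexp, ← eexpNeg_sum]
  simpa only [zero_add] using tendsto_lintegral_eexpNeg_sum (μ := μ) (measurable_const (a := 0))
    (f := fun i ω => f (net.uav i ω)) fun i => hf.comp (net.uav_poisson.measurable i)

theorem lintegral_eexpNeg_interference {s t : ℝ} (hs : 0 ≤ s) (ht : 0 ≤ t) :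
    ∫⁻ ω, eexpNeg (ENNReal.ofReal s * net.intra ω + ENNReal.ofReal t * net.inter ω) ∂μ =
      ENNReal.ofReal (S.La s) * ENNReal.ofReal (S.Le t) := by
  have hcomponents := net.measurable_components
  have hlim := tendsto_lintegral_eexpNeg_sum (μ := μ)
    (y := fun ω => ENNReal.ofReal s * S.clusterInterference none (net.components ω))
    (f := fun i ω => ENNReal.ofReal t * S.clusterInterference (some i) (net.components ω))
    (by fun_prop) (fun i => by fun_prop)
  simp_rw [net.lintegral_eexpNeg_truncated hs t, ENNReal.tsum_mul_left,
    ← net.intra_eq_clusterInterference, ← net.inter_eq_tsum_clusterInterference] at hlim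
  exact tendsto_nhds_unique hlim (ENNReal.Tendsto.const_mul
    (net.tendsto_lintegral_prod_clusterLaplace ht) (Or.inr ENNReal.ofReal_ne_top))

end Network

/-! ### The tail of the desired fading power and its approximation -/

namespace Setting

variable (S : Setting)

lemma eta_pos (κ : Link) : 0 < S.eta κ := alzerRate_pos (S.Nak κ) (S.Nak_cast_pos κ)

lemma signalScale_eq_mul_pathLoss (κ : Link) (w : ℝ) :
    S.signalScale κ w = S.gainValue 0 * S.pathLoss κ w := by
  have hbase : 0 ≤ w ^ 2 + S.dh ^ 2 := by positivity
  rw [signalScale, pathLoss, Real.sqrt_eq_rpow, ← Real.rpow_mul hbase, Real.rpow_neg hbase,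
    mul_one_div, mul_assoc, div_eq_mul_inv (S.C κ)]

lemma signalScale_pos (κ : Link) (w : ℝ) : 0 < S.signalScale κ w := by
  rw [signalScale_eq_mul_pathLoss]
  exact mul_pos S.gainValue_zero_pos (S.pathLoss_pos κ w)

lemma approxTail_mem_Icc (κ : Link) (x : ℝ≥0∞) : S.approxTail κ x ∈ Icc (0 : ℝ) 1 := by
  have hbase : 0 ≤ 1 - expNeg (ENNReal.ofReal (S.eta κ) * x) := sub_nonneg.2 (expNeg_le_one _)
  exact ⟨sub_nonneg.2 (pow_le_one₀ hbase (sub_le_self _ (expNeg_nonneg _))),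
    sub_le_self _ (pow_nonneg hbase _)⟩

@[fun_prop]
lemma measurable_approxTail (κ : Link) : Measurable (S.approxTail κ) := by
  unfold approxTail
  fun_prop

lemma approxTail_top (κ : Link) : S.approxTail κ ∞ = 0 := by
  rw [approxTail, ENNReal.mul_top (ENNReal.ofReal_pos.2 (S.eta_pos κ)).ne', expNeg_top, sub_zero,
    one_pow, sub_self]

lemma approxTail_of_ne_top (κ : Link) {x : ℝ≥0∞} (hx : x ≠ ∞) :
    S.approxTail κ x = 1 - (1 - Real.exp (-(S.eta κ * x.toReal))) ^ S.Nak κ := by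
  have hη := (S.eta_pos κ).le
  rw [approxTail, ← expNeg_ofReal (mul_nonneg hη ENNReal.toReal_nonneg), ENNReal.ofReal_mul hη,
    ENNReal.ofReal_toReal hx]

/-- The probability that the fading power in state `κ` exceeds `x`. -/
def fadingTail (κ : Link) (x : ℝ≥0∞) : ℝ≥0∞ :=
  gammaMeasure (S.Nak κ) (S.Nak κ) {b | x < ENNReal.ofReal b}

@[fun_prop]
lemma measurable_fadingTail (κ : Link) : Measurable (S.fadingTail κ) :=
  Antitone.measurable fun _ _ hxy => measure_mono fun _ hb => hxy.trans_lt hb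

lemma fadingTail_le_one (κ : Link) (x : ℝ≥0∞) : S.fadingTail κ x ≤ 1 := prob_le_one

lemma fadingTail_top (κ : Link) : S.fadingTail κ ∞ = 0 := by
  simp [fadingTail]

lemma toReal_fadingTail_of_ne_top (κ : Link) {x : ℝ≥0∞} (hx : x ≠ ∞) :
    (S.fadingTail κ x).toReal = (gammaMeasure (S.Nak κ) (S.Nak κ)).real (Ioi x.toReal) := by
  have hset : {b : ℝ | x < ENNReal.ofReal b} = Ioi x.toReal :=
    Set.ext fun b => ENNReal.lt_ofReal_iff_toReal_lt hx
  rw [fadingTail, hset, measureReal_def]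

lemma toReal_fadingTail_le_approxTail (κ : Link) (x : ℝ≥0∞) :
    (S.fadingTail κ x).toReal ≤ S.approxTail κ x := by
  rcases eq_or_ne x ∞ with rfl | hx
  · rw [S.fadingTail_top, S.approxTail_top, ENNReal.toReal_zero]
  · rw [S.toReal_fadingTail_of_ne_top κ hx, S.approxTail_of_ne_top κ hx]
    exact gammaMeasure_real_Ioi_le (Nat.pos_iff_ne_zero.1 (S.Nak_pos κ)) (S.Nak_cast_pos κ)
      ENNReal.toReal_nonneg

lemma toReal_fadingTail_eq_approxTail {κ : Link} (hκ : S.Nak κ = 1) (x : ℝ≥0∞) :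
    (S.fadingTail κ x).toReal = S.approxTail κ x := by
  have hη : S.eta κ = 1 := by simp [eta, hκ]
  rcases eq_or_ne x ∞ with rfl | hx
  · rw [S.fadingTail_top, S.approxTail_top, ENNReal.toReal_zero]
  · rw [S.toReal_fadingTail_of_ne_top κ hx, S.approxTail_of_ne_top κ hx, hη, hκ, pow_one,
      sub_sub_cancel, Nat.cast_one, gammaMeasure_one_real_Ioi one_pos ENNReal.toReal_nonneg]

lemma abs_toReal_fadingTail_sub_approxTail_le {κ : Link} {δ : ℝ}
    (hδ : ∀ x : ℝ, 0 ≤ x → |(gammaMeasure (S.Nak κ) (S.Nak κ)).real (Ioi x) -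
      (1 - (1 - Real.exp (-(S.eta κ * x))) ^ S.Nak κ)| ≤ δ) (x : ℝ≥0∞) :
    |(S.fadingTail κ x).toReal - S.approxTail κ x| ≤ δ := by
  rcases eq_or_ne x ∞ with rfl | hx
  · rw [S.fadingTail_top, S.approxTail_top, ENNReal.toReal_zero, sub_zero, abs_zero]
    exact (abs_nonneg _).trans (hδ 0 le_rfl)
  · rw [S.toReal_fadingTail_of_ne_top κ hx, S.approxTail_of_ne_top κ hx]
    exact hδ _ ENNReal.toReal_nonneg

/-- The fading level that a desired link in state `κ` at distance `w` has to exceed, if the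
interference is `y`; it extends `Network.level` from the realized to arbitrary values. -/
def fadingLevel (T : ℝ) (κ : Link) (w : ℝ) (y : ℝ≥0∞) : ℝ≥0∞ :=
  ENNReal.ofReal (T / (S.gainValue 0 * S.pathLoss κ w)) * (y + ENNReal.ofReal (S.noise / S.Pu))

@[fun_prop]
lemma measurable_fadingLevel {α : Type*} [MeasurableSpace α] (T : ℝ) (κ : Link) {w : α → ℝ}
    {y : α → ℝ≥0∞} (hw : Measurable w) (hy : Measurable y) :
    Measurable fun x => S.fadingLevel T κ (w x) (y x) := by
  unfold fadingLevel
  fun_prop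

lemma lt_div_iff_fadingLevel_lt {T : ℝ} (hT : 0 < T) (κ : Link) (w : ℝ) (y : ℝ≥0∞) (b : ℝ) :
    ENNReal.ofReal T < ENNReal.ofReal (S.pathLoss κ w * S.gainValue 0 * b) /
        (y + ENNReal.ofReal (S.noise / S.Pu)) ↔
      S.fadingLevel T κ w y < ENNReal.ofReal b := by
  have hc : 0 < S.gainValue 0 * S.pathLoss κ w := mul_pos S.gainValue_zero_pos (S.pathLoss_pos κ w)
  have hnoise : 0 < S.noise / S.Pu := div_pos S.noise_pos S.Pu_pos
  unfold fadingLevel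
  set c := S.gainValue 0 * S.pathLoss κ w
  set z := y + ENNReal.ofReal (S.noise / S.Pu) with hz
  have hz0 : z ≠ 0 := by
    simp only [hz, ne_eq, add_eq_zero, ENNReal.ofReal_eq_zero, not_and, not_le, hnoise,
      implies_true]
  rcases eq_or_ne z ∞ with hz_top | hz_top
  · simp [hz_top, ENNReal.mul_top (ENNReal.ofReal_pos.2 (div_pos hT hc)).ne']
  have hTz : ENNReal.ofReal T * z = ENNReal.ofReal c * (ENNReal.ofReal (T / c) * z) := by
    rw [← mul_assoc, ← ENNReal.ofReal_mul hc.le, mul_div_cancel₀ _ hc.ne']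
  rw [ENNReal.lt_div_iff_mul_lt (Or.inl hz0) (Or.inl hz_top), mul_comm (S.pathLoss κ w),
    ENNReal.ofReal_mul hc.le, hTz,
    ENNReal.mul_lt_mul_iff_right (ENNReal.ofReal_pos.2 hc).ne' ENNReal.ofReal_ne_top]

lemma measurable_desiredGain : Measurable fun m : Mark => S.desiredGain m.offset m :=
  S.measurable_comp_linkState (r := fun m : Mark => ‖m.offset‖) (m := id)
    (F := fun κ m => S.pathLoss κ ‖m.offset‖ * S.gainValue 0 * m.fading κ) (by fun_prop)
    measurable_id fun κ => by fun_prop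

lemma markDist_lt_desiredGain_div {T : ℝ} (hT : 0 < T) (y : ℝ≥0∞) :
    S.markDist {m | ENNReal.ofReal T < ENNReal.ofReal (S.desiredGain m.offset m) /
        (y + ENNReal.ofReal (S.noise / S.Pu))} =
      ∫⁻ u, ∑ κ, ENNReal.ofReal (S.linkProb κ (S.cellIndex ‖u‖)) *
        S.fadingTail κ (S.fadingLevel T κ ‖u‖ y) ∂S.shape.law := by
  let E (κ : Link) : Set (Plane × ℝ × (Link → ℝ)) :=
    {p | S.fadingLevel T κ ‖p.1‖ y < ENNReal.ofReal (p.2.2 κ)}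
  have hE (κ : Link) : MeasurableSet (E κ) := measurableSet_lt (by fun_prop) (by fun_prop)
  have hdesired := S.measurable_desiredGain
  have hevent : MeasurableSet {m : Mark | ENNReal.ofReal T <
      ENNReal.ofReal (S.desiredGain m.offset m) / (y + ENNReal.ofReal (S.noise / S.Pu))} :=
    measurableSet_lt measurable_const (by fun_prop)
  have htail (u : Plane) (κ : Link) :
      ∫⁻ a, ∫⁻ b, (E κ).indicator 1 (u, a, b) ∂S.fadingLaw ∂S.gainLaw =
        S.fadingTail κ (S.fadingLevel T κ ‖u‖ y) := by
    have hset : MeasurableSet {b | S.fadingLevel T κ ‖u‖ y < ENNReal.ofReal b} :=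
      measurableSet_lt measurable_const (by fun_prop)
    calc ∫⁻ a, ∫⁻ b, (E κ).indicator 1 (u, a, b) ∂S.fadingLaw ∂S.gainLaw
      _ = ∫⁻ _, ∫⁻ b, {x | S.fadingLevel T κ ‖u‖ y < ENNReal.ofReal x}.indicator 1 (b κ)
          ∂S.fadingLaw ∂S.gainLaw := rfl
      _ = S.fadingTail κ (S.fadingLevel T κ ‖u‖ y) := by
        rw [lintegral_const, measure_univ, mul_one,
          S.lintegral_fadingLaw_eval κ (measurable_one.indicator hset),
          lintegral_indicator_one hset, fadingTail]
  rw [← lintegral_indicator_one hevent]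
  have h := S.lintegral_markDist_linkState 0 (F := fun κ => (E κ).indicator 1)
    fun κ => measurable_one.indicator (hE κ)
  simp only [zero_add, htail] at h
  rw [← h]
  refine lintegral_congr fun m => ?_
  exact indicator_eq_indicator (S.lt_div_iff_fadingLevel_lt hT _ _ _ _) rfl

end Setting

namespace Network

variable {S : Setting} {Ω : Type*} [MeasurableSpace Ω] {μ : Measure Ω} (net : Network S μ)

lemma measurable_comp_level (T : ℝ) {β : Type*} [MeasurableSpace β] {A : Link → ℝ≥0∞ → β}
    (hA : ∀ κ, Measurable (A κ)) : Measurable fun ω => A (net.state₀ ω) (net.level T ω) := by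
  have hmark₀ := net.measurable_mark₀
  exact S.measurable_comp_linkState (r := fun ω => ‖(net.mark₀ ω).offset‖) (m := net.mark₀)
    (F := fun κ ω => A κ (S.fadingLevel T κ ‖(net.mark₀ ω).offset‖ (net.interference ω)))
    (by fun_prop) hmark₀ fun κ => (hA κ).comp (by fun_prop)

variable [IsProbabilityMeasure μ]

lemma lintegral_comp_level (T : ℝ) {A : Link → ℝ≥0∞ → ℝ≥0∞} (hA : ∀ κ, Measurable (A κ)) :
    ∫⁻ ω, A (net.state₀ ω) (net.level T ω) ∂μ =
      ∫⁻ ω, ∫⁻ u, ∑ κ, ENNReal.ofReal (S.linkProb κ (S.cellIndex ‖u‖)) *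
        A κ (S.fadingLevel T κ ‖u‖ (net.interference ω)) ∂S.shape.law ∂μ := by
  have hG : Measurable fun p : Mark × ℝ≥0∞ => A (S.linkState ‖p.1.offset‖ p.1)
      (S.fadingLevel T (S.linkState ‖p.1.offset‖ p.1) ‖p.1.offset‖ p.2) :=
    S.measurable_comp_linkState (r := fun p : Mark × ℝ≥0∞ => ‖p.1.offset‖) (m := Prod.fst)
      (F := fun κ p => A κ (S.fadingLevel T κ ‖p.1.offset‖ p.2)) (by fun_prop) measurable_fst
      fun κ => (hA κ).comp (by fun_prop)
  refine (net.lintegral_mark₀_interference hG).trans (lintegral_congr fun ω => ?_)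
  have hmark := S.lintegral_markDist_linkState 0
    (F := fun κ p => A κ (S.fadingLevel T κ ‖p.1‖ (net.interference ω)))
    fun κ => (hA κ).comp (by fun_prop)
  simpa only [zero_add, lintegral_const, measure_univ, mul_one] using hmark

lemma measure_lt_sinr {T : ℝ} (hT : 0 < T) :
    μ {ω | ENNReal.ofReal T < net.sinr ω} =
      ∫⁻ ω, S.fadingTail (net.state₀ ω) (net.level T ω) ∂μ := by
  let E : Set (Mark × ℝ≥0∞) := {p | ENNReal.ofReal T <
    ENNReal.ofReal (S.desiredGain p.1.offset p.1) / (p.2 + ENNReal.ofReal (S.noise / S.Pu))}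
  have hdesired := S.measurable_desiredGain
  have hE : MeasurableSet E := measurableSet_lt measurable_const <|
    (hdesired.comp measurable_fst).ennreal_ofReal.div (measurable_snd.add_const _)
  have hpair : Measurable fun ω => (net.mark₀ ω, net.interference ω) :=
    net.measurable_mark₀.prodMk net.measurable_interference
  calc μ {ω | ENNReal.ofReal T < net.sinr ω}
    _ = ∫⁻ ω, E.indicator 1 (net.mark₀ ω, net.interference ω) ∂μ :=
      (lintegral_indicator_one (hpair hE)).symm
    _ = ∫⁻ ω, S.markDist {m | (m, net.interference ω) ∈ E} ∂μ := by
      rw [net.lintegral_mark₀_interference (measurable_one.indicator hE)]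
      exact lintegral_congr fun ω => lintegral_indicator_one (measurable_prodMk_right hE)
    _ = ∫⁻ ω, S.fadingTail (net.state₀ ω) (net.level T ω) ∂μ := by
      rw [net.lintegral_comp_level T S.measurable_fadingTail]
      exact lintegral_congr fun ω => S.markDist_lt_desiredGain_div hT _

lemma integrable_approxTail_level (T : ℝ) :
    Integrable (fun ω => S.approxTail (net.state₀ ω) (net.level T ω)) μ :=
  .of_mem_Icc 0 1 (net.measurable_comp_level T S.measurable_approxTail).aemeasurable
    (.of_forall fun _ => S.approxTail_mem_Icc _ _)

lemma integrable_fadingTail_level (T : ℝ) :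
    Integrable (fun ω => (S.fadingTail (net.state₀ ω) (net.level T ω)).toReal) μ :=
  .of_mem_Icc 0 1 (net.measurable_comp_level T S.measurable_fadingTail).ennreal_toReal.aemeasurable
    (.of_forall fun _ => ⟨ENNReal.toReal_nonneg,
      ENNReal.toReal_le_of_le_ofReal zero_le_one (by simpa using S.fadingTail_le_one _ _)⟩)

theorem coverage_eq_integral_fadingTail {T : ℝ} (hT : 0 < T) :
    net.coverage T = ∫ ω, (S.fadingTail (net.state₀ ω) (net.level T ω)).toReal ∂μ := by
  rw [coverage, measureReal_def, net.measure_lt_sinr hT, integral_toReal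
    (net.measurable_comp_level T S.measurable_fadingTail).aemeasurable
    (.of_forall fun _ => (S.fadingTail_le_one _ _).trans_lt ENNReal.one_lt_top)]

theorem coverage_le_integral_approxTail {T : ℝ} (hT : 0 < T) :
    net.coverage T ≤ ∫ ω, S.approxTail (net.state₀ ω) (net.level T ω) ∂μ := by
  rw [net.coverage_eq_integral_fadingTail hT]
  exact integral_mono (net.integrable_fadingTail_level T) (net.integrable_approxTail_level T)
    fun _ => S.toReal_fadingTail_le_approxTail _ _

theorem coverage_eq_integral_approxTail (hN : ∀ κ, S.Nak κ = 1) {T : ℝ} (hT : 0 < T) :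
    net.coverage T = ∫ ω, S.approxTail (net.state₀ ω) (net.level T ω) ∂μ := by
  rw [net.coverage_eq_integral_fadingTail hT]
  exact integral_congr_ae (.of_forall fun _ => S.toReal_fadingTail_eq_approxTail (hN _) _)

theorem abs_coverage_sub_integral_approxTail_le {T : ℝ} (hT : 0 < T) {δ : ℝ}
    (hδ : ∀ (κ : Link) (x : ℝ), 0 ≤ x → |(gammaMeasure (S.Nak κ) (S.Nak κ)).real (Ioi x) -
      (1 - (1 - Real.exp (-(S.eta κ * x))) ^ S.Nak κ)| ≤ δ) :
    |net.coverage T - ∫ ω, S.approxTail (net.state₀ ω) (net.level T ω) ∂μ| ≤ δ := by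
  rw [net.coverage_eq_integral_fadingTail hT, ← integral_sub (net.integrable_fadingTail_level T)
    (net.integrable_approxTail_level T), ← Real.norm_eq_abs]
  exact (norm_integral_le_of_norm_le_const (C := δ) (.of_forall fun ω =>
    S.abs_toReal_fadingTail_sub_approxTail_le (hδ (net.state₀ ω)) (net.level T ω))).trans_eq
    (by simp)

end Network

/-! ### The analytical expression -/

lemma one_sub_one_sub_pow {R : Type*} [CommRing R] (y : R) (N : ℕ) :
    1 - (1 - y) ^ N = ∑ n ∈ Finset.Icc 1 N, (-1) ^ (n + 1) * (N.choose n : R) * y ^ n := by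
  have hbinomial : (1 - y) ^ N = ∑ n ∈ Finset.Ico 0 (N + 1), (-y) ^ n * (N.choose n : R) := by
    rw [sub_eq_neg_add, add_pow, Finset.range_eq_Ico]
    simp only [one_pow, mul_one]
  rw [hbinomial, Finset.sum_eq_sum_Ico_succ_bot N.add_one_pos, zero_add, pow_zero, one_mul,
    Nat.choose_zero_right, Nat.cast_one, sub_add_cancel_left, ← Finset.sum_neg_distrib,
    Finset.Ico_add_one_right_eq_Icc]
  refine Finset.sum_congr rfl fun n _ => ?_
  rw [neg_pow y n]
  ring

namespace Setting

variable (S : Setting)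

lemma userLaplace_zero_left (v : Plane) : S.userLaplace 0 v = 1 := by
  simp only [userLaplace, ENNReal.ofReal_zero, zero_mul, eexpNeg_zero, lintegral_one, measure_univ]

lemma Oa_zero : S.Oa 0 = 1 := by
  rw [← ENNReal.ofReal_eq_one, ← S.userLaplace_zero le_rfl, S.userLaplace_zero_left]

lemma La_zero : S.La 0 = 1 := by
  rw [La_eq_intraFactor, Oa_zero]
  cases S.number <;> simp [UserNumber.intraFactor]

lemma clusterLaplace_zero (v : Plane) : S.clusterLaplace 0 v = 1 := by
  rw [clusterLaplace, userLaplace_zero_left, ENNReal.toReal_one]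
  cases S.number <;> simp [clusterFactor]

lemma Le_zero : S.Le 0 = 1 := by
  rw [← ENNReal.ofReal_eq_one, S.ofReal_Le le_rfl]
  simp only [clusterLaplace_zero, sub_self, ENNReal.ofReal_zero, lintegral_zero, mul_zero,
    eexpNeg_zero]

lemma La_nonneg {s : ℝ} (hs : 0 ≤ s) : 0 ≤ S.La s := by
  rw [La_eq_intraFactor]
  cases S.number with
  | fixed N hN => exact pow_nonneg (S.Oa_pos hs).le _
  | random n hn => exact (Real.exp_pos _).le

lemma Le_nonneg (s : ℝ) : 0 ≤ S.Le s := expNeg_nonneg _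

lemma expNeg_fadingLevel_pow {T : ℝ} (hT : 0 ≤ T) (κ : Link) (w : ℝ) (y : ℝ≥0∞) (n : ℕ) :
    expNeg (ENNReal.ofReal (S.eta κ) * S.fadingLevel T κ w y) ^ n =
      Real.exp (-((n : ℝ) * S.eta κ * T * S.noise / (S.Pu * S.signalScale κ w))) *
        expNeg (ENNReal.ofReal ((n : ℝ) * S.eta κ * T / S.signalScale κ w) * y) := by
  have hη := (S.eta_pos κ).le
  have hnoise := (div_pos S.noise_pos S.Pu_pos).le
  have hs : 0 ≤ (n : ℝ) * S.eta κ * T / S.signalScale κ w :=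
    div_nonneg (by positivity) (S.signalScale_pos κ w).le
  have hcoeff : (n : ℝ≥0∞) * (ENNReal.ofReal (S.eta κ) *
      ENNReal.ofReal (T / S.signalScale κ w)) =
        ENNReal.ofReal ((n : ℝ) * S.eta κ * T / S.signalScale κ w) := by
    rw [← ENNReal.ofReal_natCast n, ← ENNReal.ofReal_mul hη, ← ENNReal.ofReal_mul n.cast_nonneg,
      ← mul_div_assoc, ← mul_div_assoc, ← mul_assoc]
  have hexponent : (n : ℝ) * S.eta κ * T * S.noise / (S.Pu * S.signalScale κ w) =
      (n : ℝ) * S.eta κ * T / S.signalScale κ w * (S.noise / S.Pu) := by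
    rw [div_mul_div_comm, mul_comm S.Pu]
  rw [expNeg_pow, fadingLevel, ← signalScale_eq_mul_pathLoss, hexponent,
    ← expNeg_ofReal (mul_nonneg hs hnoise), ← expNeg_add, ENNReal.ofReal_mul hs, ← hcoeff]
  congr 1
  ring

lemma approxTail_fadingLevel {T : ℝ} (hT : 0 ≤ T) (κ : Link) (w : ℝ) (y : ℝ≥0∞) :
    S.approxTail κ (S.fadingLevel T κ w y) = ∑ n ∈ Finset.Icc 1 (S.Nak κ),
      (-1) ^ (n + 1) * ((S.Nak κ).choose n : ℝ) *
        (Real.exp (-((n : ℝ) * S.eta κ * T * S.noise / (S.Pu * S.signalScale κ w))) *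
          expNeg (ENNReal.ofReal ((n : ℝ) * S.eta κ * T / S.signalScale κ w) * y)) := by
  rw [approxTail, one_sub_one_sub_pow]
  simp_rw [S.expNeg_fadingLevel_pow hT]

end Setting

namespace Network

variable {S : Setting} {Ω : Type*} [MeasurableSpace Ω] {μ : Measure Ω} (net : Network S μ)

/-- The probability of coverage for a desired link in state `κ` at distance `w`, with the tail of
the fading power replaced by its approximation. -/
def meanTail (T : ℝ) (κ : Link) (w : ℝ) : ℝ :=
  ∫ ω, S.approxTail κ (S.fadingLevel T κ w (net.interference ω)) ∂μ

/-- The average of `meanTail` over the state of a desired link at distance `w`. -/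
def meanTailAt (T w : ℝ) : ℝ := ∑ κ, S.linkProb κ (S.cellIndex w) * net.meanTail T κ w

variable [IsProbabilityMeasure μ]

lemma integral_expNeg_intra {s : ℝ} (hs : 0 ≤ s) :
    ∫ ω, expNeg (ENNReal.ofReal s * net.intra ω) ∂μ = S.La s := by
  have h := net.lintegral_eexpNeg_interference hs le_rfl
  simp only [ENNReal.ofReal_zero, zero_mul, add_zero, S.Le_zero, ENNReal.ofReal_one, mul_one] at h
  rw [integral_expNeg (net.measurable_intra.const_mul _).aemeasurable, h,
    ENNReal.toReal_ofReal (S.La_nonneg hs)]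

lemma integral_expNeg_inter {s : ℝ} (hs : 0 ≤ s) :
    ∫ ω, expNeg (ENNReal.ofReal s * net.inter ω) ∂μ = S.Le s := by
  have h := net.lintegral_eexpNeg_interference le_rfl hs
  simp only [ENNReal.ofReal_zero, zero_mul, zero_add, S.La_zero, ENNReal.ofReal_one, one_mul] at h
  rw [integral_expNeg (net.measurable_inter.const_mul _).aemeasurable, h,
    ENNReal.toReal_ofReal (S.Le_nonneg s)]

lemma integral_expNeg_interference {s : ℝ} (hs : 0 ≤ s) :
    ∫ ω, expNeg (ENNReal.ofReal s * net.interference ω) ∂μ = S.La s * S.Le s := by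
  rw [integral_expNeg (net.measurable_interference.const_mul _).aemeasurable]
  simp_rw [interference, mul_add]
  rw [net.lintegral_eexpNeg_interference hs hs, ENNReal.toReal_mul,
    ENNReal.toReal_ofReal (S.La_nonneg hs), ENNReal.toReal_ofReal (S.Le_nonneg s)]

lemma integrable_approxTail_fadingLevel (T : ℝ) (κ : Link) (w : ℝ) :
    Integrable (fun ω => S.approxTail κ (S.fadingLevel T κ w (net.interference ω))) μ := by
  have hmeas : Measurable fun ω => S.approxTail κ (S.fadingLevel T κ w (net.interference ω)) := by
    fun_prop
  exact .of_mem_Icc 0 1 hmeas.aemeasurable (.of_forall fun _ => S.approxTail_mem_Icc _ _)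

lemma meanTail_mem_Icc (T : ℝ) (κ : Link) (w : ℝ) : net.meanTail T κ w ∈ Icc (0 : ℝ) 1 :=
  ⟨integral_nonneg fun _ => (S.approxTail_mem_Icc _ _).1,
    (integral_mono (net.integrable_approxTail_fadingLevel T κ w) (integrable_const 1)
      fun _ => (S.approxTail_mem_Icc _ _).2).trans_eq (by simp)⟩

@[fun_prop]
lemma measurable_meanTail (T : ℝ) (κ : Link) : Measurable (net.meanTail T κ) := by
  have hjoint : Measurable fun p : ℝ × Ω =>
      S.approxTail κ (S.fadingLevel T κ p.1 (net.interference p.2)) := by fun_prop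
  exact hjoint.stronglyMeasurable.integral_prod_right'.measurable

lemma meanTail_mul_pdfIntra {T : ℝ} (hT : 0 ≤ T) (κ : Link) (w : ℝ) :
    net.meanTail T κ w * S.shape.pdfIntra w = S.Psi T κ w := by
  have hs (n : ℕ) : 0 ≤ (n : ℝ) * S.eta κ * T / S.signalScale κ w :=
    div_nonneg (mul_nonneg (mul_nonneg n.cast_nonneg (S.eta_pos κ).le) hT)
      (S.signalScale_pos κ w).le
  have hint (n : ℕ) : Integrable (fun ω => expNeg (ENNReal.ofReal
      ((n : ℝ) * S.eta κ * T / S.signalScale κ w) * net.interference ω)) μ := by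
    have hmeas : Measurable fun ω => expNeg (ENNReal.ofReal
        ((n : ℝ) * S.eta κ * T / S.signalScale κ w) * net.interference ω) := by fun_prop
    exact .of_mem_Icc 0 1 hmeas.aemeasurable
      (.of_forall fun _ => ⟨expNeg_nonneg _, expNeg_le_one _⟩)
  simp_rw [meanTail, S.approxTail_fadingLevel hT]
  rw [integral_finsetSum _ fun n _ => ((hint n).const_mul _).const_mul _, Setting.Psi,
    Finset.sum_mul]
  refine Finset.sum_congr rfl fun n _ => ?_
  rw [integral_const_mul, integral_const_mul, net.integral_expNeg_interference (hs n)]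
  ring

lemma meanTailAt_mem_Icc (T w : ℝ) : net.meanTailAt T w ∈ Icc (0 : ℝ) 1 := by
  have hprob (κ : Link) := S.linkProb_nonneg κ (S.cellIndex w)
  refine ⟨Finset.sum_nonneg fun κ _ => mul_nonneg (hprob κ) (net.meanTail_mem_Icc T κ w).1, ?_⟩
  calc net.meanTailAt T w
    _ ≤ ∑ κ, S.linkProb κ (S.cellIndex w) :=
      Finset.sum_le_sum fun κ _ => mul_le_of_le_one_right (hprob κ) (net.meanTail_mem_Icc T κ w).2
    _ = 1 := by rw [Link.sum_eq, S.linkProb_los_add_nlos]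

@[fun_prop]
lemma measurable_meanTailAt (T : ℝ) : Measurable (net.meanTailAt T) := by
  unfold meanTailAt
  fun_prop

lemma meanTailAt_mul_pdfIntra {T : ℝ} (hT : 0 ≤ T) (w : ℝ) :
    net.meanTailAt T w * S.shape.pdfIntra w = S.integrand T (S.cellIndex w) w := by
  rw [Setting.integrand, ← net.meanTail_mul_pdfIntra hT, ← net.meanTail_mul_pdfIntra hT,
    meanTailAt, Link.sum_eq]
  ring

lemma integrableOn_integrand (net : Network S μ) {T : ℝ} (hT : 0 ≤ T) :
    IntegrableOn (fun w => S.integrand T (S.cellIndex w) w) (Ioi 0) := by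
  simp_rw [← net.meanTailAt_mul_pdfIntra hT]
  refine S.shape.hasNormDensity_law.integrableOn.bdd_mul (c := 1)
    (net.measurable_meanTailAt T).aestronglyMeasurable (.of_forall fun w => ?_)
  rw [Real.norm_of_nonneg (net.meanTailAt_mem_Icc T w).1]
  exact (net.meanTailAt_mem_Icc T w).2

lemma ofReal_meanTailAt (T w : ℝ) :
    ENNReal.ofReal (net.meanTailAt T w) =
      ∫⁻ ω, ∑ κ, ENNReal.ofReal (S.linkProb κ (S.cellIndex w)) *
        ENNReal.ofReal (S.approxTail κ (S.fadingLevel T κ w (net.interference ω))) ∂μ := by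
  have hmeas (κ : Link) : Measurable fun ω => ENNReal.ofReal
      (S.approxTail κ (S.fadingLevel T κ w (net.interference ω))) := by fun_prop
  have hprob (κ : Link) := S.linkProb_nonneg κ (S.cellIndex w)
  rw [lintegral_finsetSum _ fun κ _ => (hmeas κ).const_mul _, meanTailAt,
    ENNReal.ofReal_sum_of_nonneg fun κ _ => mul_nonneg (hprob κ) (net.meanTail_mem_Icc T κ w).1]
  refine Finset.sum_congr rfl fun κ _ => ?_
  rw [lintegral_const_mul _ (hmeas κ), ENNReal.ofReal_mul (hprob κ), meanTail,
    ofReal_integral_eq_lintegral_ofReal (net.integrable_approxTail_fadingLevel T κ w)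
      (.of_forall fun _ => (S.approxTail_mem_Icc _ _).1)]

lemma lintegral_approxTail_level (T : ℝ) :
    ∫⁻ ω, ENNReal.ofReal (S.approxTail (net.state₀ ω) (net.level T ω)) ∂μ =
      ∫⁻ u, ENNReal.ofReal (net.meanTailAt T ‖u‖) ∂S.shape.law := by
  simp_rw [ofReal_meanTailAt]
  rw [net.lintegral_comp_level T (A := fun κ x => ENNReal.ofReal (S.approxTail κ x))
    fun κ => by fun_prop]
  exact lintegral_lintegral_swap (Measurable.aemeasurable (by fun_prop))

theorem integral_approxTail_level {T : ℝ} (hT : 0 ≤ T) :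
    ∫ ω, S.approxTail (net.state₀ ω) (net.level T ω) ∂μ = S.coverageFormula T := by
  have hint := net.integrableOn_integrand hT
  have hnonneg (w : ℝ) : 0 ≤ net.meanTailAt T w := (net.meanTailAt_mem_Icc T w).1
  have hintegrand : 0 ≤ᵐ[volume.restrict (Ioi 0)] fun w => S.integrand T (S.cellIndex w) w := by
    filter_upwards [S.shape.hasNormDensity_law.ae_nonneg] with w hw
    exact net.meanTailAt_mul_pdfIntra hT w ▸ mul_nonneg (hnonneg w) hw
  calc ∫ ω, S.approxTail (net.state₀ ω) (net.level T ω) ∂μ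
    _ = (∫⁻ u, ENNReal.ofReal (net.meanTailAt T ‖u‖) ∂S.shape.law).toReal := by
      rw [integral_eq_lintegral_of_nonneg_ae (.of_forall fun _ => (S.approxTail_mem_Icc _ _).1)
        (net.integrable_approxTail_level T).1, net.lintegral_approxTail_level]
    _ = ∫ w in Ioi 0, S.integrand T (S.cellIndex w) w := by
      rw [S.shape.hasNormDensity_law.lintegral_norm (fun w => ENNReal.ofReal (net.meanTailAt T w))
        (by fun_prop), integral_eq_lintegral_of_nonneg_ae hintegrand hint.1]
      simp_rw [← net.meanTailAt_mul_pdfIntra hT, ENNReal.ofReal_mul (hnonneg _)]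
    _ = S.coverageFormula T := (S.hasSum_integral_cell hint).tsum_eq.symm

end Network

end UAVUplink

end

theorem theorem2 {Ω : Type*} [MeasurableSpace Ω] (μ : Measure Ω) [IsProbabilityMeasure μ]
    (S : UAVUplink.Setting) (net : UAVUplink.Network S μ) (T : ℝ) (hT : 0 < T) :
    -- the two factors are the Laplace transforms of the two kinds of interference
    (∀ s : ℝ, 0 ≤ s → ∫ ω, UAVUplink.expNeg (ENNReal.ofReal s * net.intra ω) ∂μ = S.La s) ∧
    (∀ s : ℝ, 0 ≤ s → ∫ ω, UAVUplink.expNeg (ENNReal.ofReal s * net.inter ω) ∂μ = S.Le s) ∧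
    -- the analytical expression is well defined
    (∀ γ : ℕ, IntervalIntegrable (S.integrand T γ) volume (S.cell γ) (S.cell (γ + 1))) ∧
    Summable (fun γ : ℕ => ∫ w in S.cell γ..S.cell (γ + 1), S.integrand T γ w) ∧
    -- it is the coverage probability with the tail of the desired fading power replaced
    ∫ ω, S.approxTail (net.state₀ ω) (net.level T ω) ∂μ = S.coverageFormula T ∧
    -- it is an upper bound,
    net.coverage T ≤ S.coverageFormula T ∧
    -- with an error of at most the uniform error of the tail approximation,
    (∀ δ : ℝ, (∀ (κ : UAVUplink.Link) (x : ℝ), 0 ≤ x →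
        |(gammaMeasure (S.Nak κ) (S.Nak κ)).real (Set.Ioi x) -
          (1 - (1 - Real.exp (-(S.eta κ * x))) ^ S.Nak κ)| ≤ δ) →
      |net.coverage T - S.coverageFormula T| ≤ δ) ∧
    -- and it is exact for Rayleigh fading
    ((∀ κ, S.Nak κ = 1) → net.coverage T = S.coverageFormula T) := by
  have hcell := net.integrableOn_integrand hT.le
  have hA := net.integral_approxTail_level hT.le
  exact ⟨fun _ hs => net.integral_expNeg_intra hs, fun _ hs => net.integral_expNeg_inter hs,
    S.intervalIntegrable_cell hcell, (S.hasSum_integral_cell hcell).summable, hA,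
    hA ▸ net.coverage_le_integral_approxTail hT,
    fun _ hδ => hA ▸ net.abs_coverage_sub_integral_approxTail_le hT hδ,
    fun hN => hA ▸ net.coverage_eq_integral_approxTail hN hT⟩
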